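/- All graphs are finite and simple. The fork is the graph obtained from a four-vertex path by adding a vertex whose only neighbour is the second vertex of the path; the antifork is its complement. A graph is uncluttered if no induced subgraph of it is isomorphic to a fork or an antifork. Distinct vertices $u,v$ of $G$ are twins if they have the same neighbours in $V(G)\setminus\{u,v\}$; a vertex is simplicial if its neighbours form a clique. For disjoint $X,Y\subseteq V(G)$, $X$ is complete (respectively anticomplete) to $Y$ if every (respectively no) vertex of $X$ is adjacent to every (respectively any) vertex of $Y$. A graph $H$ is a candelabrum with base $Z$ if for some integer $k\ge 1$ its vertex set can be partitioned into nonempty sets $Y_1,\dots,Y_k,Z_1,\dots,Z_k$ with $Z=Z_1\cup\cdots\cup Z_k$, such that each $Y_i$ is a clique and each $Z_i$ is a stable set; for $i\ne j$, $Y_i$ is anticomplete to $Y_j$ and $Z_i$ is complete to $Z_j$; and $Y_i$ is complete to $Z_j$ if $i=j$ and anticomplete to $Z_j$ if $i\neq j$. A graph $G$ is candled if it has an induced subgraph $H$ that is a candelabrum, with base $Z$ say, such that $Z$ is complete to $V(G)\setminus V(H)$ and $V(H)\setminus Z$ is anticomplete to $V(G)\setminus V(H)$ (where $V(G)\setminus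 V(H)$ may be empty). **Theorem.** Let $G$ be an uncluttered graph, with complement $\overline{G}$. Then at least one of the following holds: 1. one of $G,\overline{G}$ is disconnected; 2. one of $G,\overline{G}$ has two adjacent simplicial vertices that are twins; 3. one of $G,\overline{G}$ is candled; 4. one of $G,\overline{G}$ is the line graph of a triangle-free graph. -/

import Mathlib

open scoped SimpleGraph

namespace Uncluttered

variable {V : Type*}

/-- The fork: the four-vertex path `0 - 1 - 2 - 3` together with the vertex `4`, whose only
neighbour is the second vertex `1` of the path. -/
def fork : SimpleGraph (Fin 5) :=
  SimpleGraph.fromEdgeSet {s(0, 1), s(1, 2), s(2, 3), s(1, 4)}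

/-- The antifork: the complement of the fork. -/
def antifork : SimpleGraph (Fin 5) := forkᶜ

/-- A graph is uncluttered if no induced subgraph of it is (isomorphic to) a fork or antifork. -/
def IsUncluttered (G : SimpleGraph V) : Prop :=
  ¬ fork ⊴ G ∧ ¬ antifork ⊴ G

/-- Some two vertices are not joined by a path. (The null graph is not disconnected.) -/
def IsDisconnected (G : SimpleGraph V) : Prop :=
  ¬ G.Preconnected

/-- Every vertex of `X` is adjacent to every vertex of `Y`. -/
def CompleteTo (G : SimpleGraph V) (X Y : Set V) : Prop :=
  ∀ x ∈ X, ∀ y ∈ Y, G.Adj x y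

/-- There are no edges between `X` and `Y`. -/
def AnticompleteTo (G : SimpleGraph V) (X Y : Set V) : Prop :=
  ∀ x ∈ X, ∀ y ∈ Y, ¬ G.Adj x y

/-- Distinct vertices with the same neighbours among the other vertices. -/
def IsTwins (G : SimpleGraph V) (u v : V) : Prop :=
  u ≠ v ∧ ∀ w, w ≠ u → w ≠ v → (G.Adj u w ↔ G.Adj v w)

/-- A vertex is simplicial if the set of its neighbours is a clique. -/
def IsSimplicial (G : SimpleGraph V) (v : V) : Prop :=
  G.IsClique (G.neighborSet v)

/-- There are two adjacent twins, both of which are simplicial. -/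
def HasAdjacentSimplicialTwins (G : SimpleGraph V) : Prop :=
  ∃ u v : V, G.Adj u v ∧ IsTwins G u v ∧ IsSimplicial G u ∧ IsSimplicial G v

/-- `G` is a candelabrum with base `B`: the vertex set is partitioned into nonempty sets
`Y₁, …, Yₖ, Z₁, …, Zₖ` with `k ≥ 1`, where the `Yᵢ` are cliques, pairwise anticomplete, the `Zᵢ` are
stable sets, pairwise complete, `Yᵢ` is complete to `Zᵢ` and anticomplete to `Zⱼ` for `j ≠ i`, and
`B = Z₁ ∪ ⋯ ∪ Zₖ`. -/
def IsCandelabrum (G : SimpleGraph V) (B : Set V) : Prop :=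
  ∃ (k : ℕ) (Y Z : Fin k → Set V),
    1 ≤ k ∧
    (∀ i, (Y i).Nonempty) ∧ (∀ i, (Z i).Nonempty) ∧
    (∀ i j, i ≠ j → Disjoint (Y i) (Y j)) ∧
    (∀ i j, i ≠ j → Disjoint (Z i) (Z j)) ∧
    (∀ i j, Disjoint (Y i) (Z j)) ∧
    (⋃ i, Y i) ∪ (⋃ i, Z i) = Set.univ ∧
    (∀ i, G.IsClique (Y i)) ∧ (∀ i, G.IsIndepSet (Z i)) ∧
    (∀ i j, i ≠ j → AnticompleteTo G (Y i) (Y j)) ∧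
    (∀ i j, i ≠ j → CompleteTo G (Z i) (Z j)) ∧
    (∀ i, CompleteTo G (Y i) (Z i)) ∧
    (∀ i j, i ≠ j → AnticompleteTo G (Y i) (Z j)) ∧
    B = ⋃ i, Z i

/-- `G` is candled: for some `S ⊆ V(G)` the induced subgraph `G[S]` is a candelabrum, with base `B`
say, such that `B` is complete to `V(G) ∖ S` and `S ∖ B` is anticomplete to `V(G) ∖ S`. -/
def IsCandled (G : SimpleGraph V) : Prop :=
  ∃ (S : Set V) (B : Set S), IsCandelabrum (G.induce S) B ∧
    CompleteTo G (Subtype.val '' B) Sᶜ ∧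
    AnticompleteTo G (Subtype.val '' Bᶜ) Sᶜ

/-- `G` is (isomorphic to) the line graph of a finite triangle-free graph. -/
def IsLineGraphOfTriangleFree (G : SimpleGraph V) : Prop :=
  ∃ (n : ℕ) (H : SimpleGraph (Fin n)), H.CliqueFree 3 ∧ Nonempty (G ≃g H.lineGraph)

end Uncluttered

/-!
If `G` and `Gᶜ` are connected, the maximal proper modules of `G` partition the vertices, and
contracting them yields a prime quotient `H` without induced forks and antiforks.

In `H` or in `Hᶜ`, each neighbourhood is a disjoint union of two cliques with no edges between them.
Indeed, if `H` has a triangle and a vertex anticomplete to it, extend the triangle to a maximal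
clique `K` to which some vertex is anticomplete; primeness leaves at most one vertex complete to
`K`, and the property spreads from `K` outwards. If neither `H` nor `Hᶜ` has such a triangle, both
are claw-free, and they cannot both contain an induced diamond. A graph all of whose neighbourhoods
are of this kind is the line graph of a triangle-free graph: each vertex becomes an edge whose two
ends are given by its two cliques.

If a module of the partition contains an edge of `G`, then its vertex in `H` is simplicial, since
otherwise primeness would make it an interior vertex of an induced four-vertex path and `G` would
contain an antifork. So two adjacent vertices of such a module are simplicial twins, unless that
module or a neighbouring one contains a nonedge. If `G` and `Gᶜ` have no such twins, then either the
modules are trivial and `G = H`, or the vertices simplicial in `H` and those simplicial in `Hᶜ`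
force `H` to be split; a split prime graph with the two-clique property is, up to one further
vertex, a matching between a stable set and a clique, and `G` is candled.
-/

namespace Uncluttered

variable {V : Type*} {G : SimpleGraph V}

/-- The absence of induced forks and antiforks, in a clausal form that can be instantiated at
explicit vertices. A fork is given as its path `a - b - c - d` followed by the neighbour `e` of `b`;
an antifork as the diamond with middle vertices `a, b` and ends `c, d` followed by the
neighbour `w` of `d`. The missing distinctness assumptions follow from the adjacencies. -/
structure ForkKiteFree (G : SimpleGraph V) : Prop where
  fork : ∀ a b c d e, G.Adj a b → G.Adj b c → G.Adj c d → G.Adj b e → a ≠ e →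
    G.Adj a c ∨ G.Adj a d ∨ G.Adj a e ∨ G.Adj b d ∨ G.Adj c e ∨ G.Adj d e
  kite : ∀ a b c d w, G.Adj a b → G.Adj a c → G.Adj a d → G.Adj b c → G.Adj b d → G.Adj d w →
    G.Adj c d ∨ G.Adj a w ∨ G.Adj b w ∨ G.Adj c w

theorem ForkKiteFree.compl (h : ForkKiteFree G) : ForkKiteFree Gᶜ where
  fork a b c d e := by grind [SimpleGraph.compl_adj, G.adj_comm, h.kite a e c d b]
  kite a b c d w := by grind [SimpleGraph.compl_adj, G.adj_comm, h.fork a w c d b]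

theorem fork_isIndContained {a b c d e : V} (hab : G.Adj a b) (hbc : G.Adj b c) (hcd : G.Adj c d)
    (hbe : G.Adj b e) (hae : a ≠ e)
    (h : ¬(G.Adj a c ∨ G.Adj a d ∨ G.Adj a e ∨ G.Adj b d ∨ G.Adj c e ∨ G.Adj d e)) :
    fork ⊴ G := by
  refine ⟨⟨⟨![a, b, c, d, e], fun i j => ?_⟩, fun {i j} => ?_⟩⟩
  · fin_cases i <;> fin_cases j <;> simp <;> grind [G.adj_comm, G.ne_of_adj]
  · change G.Adj (![a, b, c, d, e] i) (![a, b, c, d, e] j) ↔ fork.Adj i j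
    fin_cases i <;> fin_cases j <;> simp [fork] <;> grind [G.adj_comm]

theorem IsUncluttered.forkKiteFree (h : IsUncluttered G) : ForkKiteFree G where
  fork _ _ _ _ _ hab hbc hcd hbe hae :=
    by_contra fun hno => h.1 (fork_isIndContained hab hbc hcd hbe hae hno)
  kite a b c d w hab hac had hbc hbd hdw := by
    by_contra hno
    have hfork : fork ⊴ Gᶜ := by
      apply fork_isIndContained (a := a) (b := w) (c := c) (d := d) (e := b) <;>
        grind [SimpleGraph.compl_adj, G.adj_comm, G.ne_of_adj]
    obtain ⟨f⟩ := hfork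
    exact h.2 ⟨by simpa only [antifork, compl_compl] using SimpleGraph.Embedding.complEquiv f⟩

/-- A homogeneous set: every vertex outside `X` is adjacent to all of `X` or to none of it. -/
def IsModule (G : SimpleGraph V) (X : Set V) : Prop :=
  ∀ ⦃x⦄, x ∈ X → ∀ ⦃y⦄, y ∈ X → ∀ ⦃v⦄, v ∉ X → G.Adj v x → G.Adj v y

/-- A graph is prime if its only modules are the empty set, the singletons and the whole vertex
set. -/
def IsPrime (G : SimpleGraph V) : Prop :=
  ∀ X : Set V, IsModule G X → X.Subsingleton ∨ X = Set.univ

theorem IsModule.compl {X : Set V} (h : IsModule G X) : IsModule Gᶜ X := by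
  intro x hx y hy v hv hvx
  rw [SimpleGraph.compl_adj] at *
  exact ⟨fun e => hv (e ▸ hy), fun hvy => hvx.2 (h hy hx hv hvy)⟩

theorem IsPrime.compl (h : IsPrime G) : IsPrime Gᶜ := fun X hX =>
  h X (by simpa only [compl_compl] using hX.compl)

theorem IsPrime.not_isModule (hP : IsPrime G) {X : Set V} {x y v : V} (hx : x ∈ X) (hy : y ∈ X)
    (hxy : x ≠ y) (hv : v ∉ X) : ¬IsModule G X := by
  intro hX
  rcases hP X hX with h | rfl
  · exact hxy (h hx hy)
  · exact hv (Set.mem_univ v)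

theorem IsPrime.exists_adj_iff_not_adj (hP : IsPrime G) {x y v : V} (hxy : x ≠ y) (hx : v ≠ x)
    (hy : v ≠ y) : ∃ t, t ≠ x ∧ t ≠ y ∧ (G.Adj t x ↔ ¬G.Adj t y) := by
  by_contra! hcon
  refine hP.not_isModule (X := {x, y}) (v := v) (by simp) (by simp) hxy (by simp [hx, hy]) ?_
  intro p hp q hq t ht htp
  simp only [Set.mem_insert_iff, Set.mem_singleton_iff, not_or] at hp hq ht
  grind

/-- The vertices reachable from `x` by walks all of whose later vertices lie in `X`; for `x ∈ X`
this is the component of `x` in the subgraph induced on `X`. -/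
def component (G : SimpleGraph V) (X : Set V) (x : V) : Set V :=
  {y | Relation.ReflTransGen (fun u v => G.Adj u v ∧ v ∈ X) x y}

theorem mem_component_self (X : Set V) (x : V) : x ∈ component G X x :=
  Relation.ReflTransGen.refl

theorem component_subset {X : Set V} {x : V} (hx : x ∈ X) : component G X x ⊆ X := by
  intro y hy
  rcases Relation.ReflTransGen.cases_tail hy with rfl | ⟨z, -, h⟩
  · exact hx
  · exact h.2

theorem mem_component_of_adj {X : Set V} {x y z : V} (hy : y ∈ component G X x) (h : G.Adj y z)
    (hz : z ∈ X) : z ∈ component G X x :=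
  Relation.ReflTransGen.tail hy ⟨h, hz⟩

theorem component_induction {X : Set V} {x : V} {p : V → Prop} (base : p x)
    (step : ∀ u ∈ component G X x, ∀ v ∈ X, G.Adj u v → p u → p v) :
    ∀ y ∈ component G X x, p y := by
  intro y hy
  induction hy with
  | refl => exact base
  | tail h1 h2 ih => exact step _ h1 _ h2.2 h2.1 ih

theorem component_exists_edge {X : Set V} {x p q : V} {P : V → Prop} (hp : p ∈ component G X x)
    (hq : q ∈ component G X x) (hPp : P p) (hPq : ¬P q) :
    ∃ u ∈ component G X x, ∃ v ∈ component G X x, G.Adj u v ∧ P u ∧ ¬P v := by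
  by_contra! hcon
  have hconst : ∀ y ∈ component G X x, (P x ↔ P y) := by
    refine component_induction Iff.rfl fun u hu v hv huv ih => ?_
    have hv' := mem_component_of_adj hu huv hv
    exact ih.trans ⟨hcon u hu v hv' huv, hcon v hv' u hu huv.symm⟩
  exact hPq ((hconst q hq).1 ((hconst p hp).2 hPp))

theorem IsPrime.exists_splits_component_edge (hP : IsPrime G) {X : Set V} {x y v : V}
    (hy : y ∈ component G X x) (hxy : x ≠ y) (hv : v ∉ component G X x) :
    ∃ z ∉ X, ∃ s ∈ component G X x, ∃ t ∈ component G X x,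
      G.Adj s t ∧ G.Adj z s ∧ ¬G.Adj z t := by
  have hnot := hP.not_isModule (mem_component_self X x) hy hxy hv
  simp only [IsModule, not_forall] at hnot
  obtain ⟨p, hp, q, hq, z, hz, hzp, hzq⟩ := hnot
  obtain ⟨s, hs, t, ht, hst, hzs, hzt⟩ := component_exists_edge (P := (G.Adj z ·)) hp hq hzp hzq
  exact ⟨z, fun hzX => hz (mem_component_of_adj hs hzs.symm hzX), s, hs, t, ht, hst, hzs, hzt⟩

theorem IsPrime.component_univ (hP : IsPrime G) {x y z : V} (hxy : x ≠ y) (hxz : x ≠ z)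
    (hyz : y ≠ z) : component G Set.univ x = Set.univ := by
  have hmodule : IsModule G (component G Set.univ x) := fun p hp q _ v hv h =>
    absurd (mem_component_of_adj hp h.symm (Set.mem_univ v)) hv
  refine (hP _ hmodule).resolve_left fun hsub => ?_
  have hiso : ∀ v, ¬G.Adj x v := fun v hv =>
    hv.ne (hsub (mem_component_self _ x) (mem_component_of_adj (mem_component_self _ x) hv trivial))
  refine hP.not_isModule (X := {x}ᶜ) (v := x) hxy.symm hxz.symm hyz (by simp) ?_
  intro p _ q _ v hv hvp
  rw [Set.mem_compl_singleton_iff, not_not] at hv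
  exact absurd (hv ▸ hvp) (hiso p)

/-- `a - b - c - d` is an induced path. -/
def IsInducedP4 (G : SimpleGraph V) (a b c d : V) : Prop :=
  G.Adj a b ∧ G.Adj b c ∧ G.Adj c d ∧ ¬G.Adj a c ∧ ¬G.Adj a d ∧ ¬G.Adj b d

/-- The common neighbours of the interior vertices of the path `y - a - n - w` that are adjacent to
neither of its ends. -/
def bullHeads (G : SimpleGraph V) (y a n w : V) : Set V :=
  {v | G.Adj a v ∧ G.Adj n v ∧ ¬G.Adj y v ∧ ¬G.Adj w v}

theorem ForkKiteFree.mem_bullHeads (hG : ForkKiteFree G) {y a n w x m k u v : V}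
    (hpath : IsInducedP4 G y a n w) (hm : m ∈ bullHeads G y a n w) (hk : k ∈ bullHeads G y a n w)
    (hu : u ∈ bullHeads G y a n w) (hv : v ∈ bullHeads G y a n w) (hmk : ¬G.Adj m k)
    (hxm : G.Adj x m) (hxk : ¬G.Adj x k) (huv : G.Adj u v) (hxu : G.Adj x u) (hxv : ¬G.Adj x v) :
    x ∈ bullHeads G y a n w := by
  obtain ⟨hya, han, hnw, hyn, -, haw⟩ := hpath
  simp only [bullHeads, Set.mem_ofPred_eq] at *
  have hwx : G.Adj x a → G.Adj x n ∨ G.Adj w x := by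
    grind [G.adj_comm, hG.kite a u x n w]
  have hyx : G.Adj x n → G.Adj x a ∨ G.Adj y x := by
    grind [G.adj_comm, hG.kite n u x a y]
  have hax : G.Adj x a ∨ G.Adj x n := by
    grind [G.adj_comm, hG.kite a n k m x]
  have hwx' : G.Adj x a → ¬G.Adj w x := by
    grind [G.adj_comm, hG.kite a u v x w]
  have hyx' : G.Adj x n → ¬G.Adj y x := by
    grind [G.adj_comm, hG.kite n u v x y]
  grind [G.adj_comm]

theorem IsPrime.bullHeads_adj_trans (hP : IsPrime G) (hG : ForkKiteFree G) {y a n w p q r : V}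
    (hpath : IsInducedP4 G y a n w) (hp : p ∈ bullHeads G y a n w) (hq : q ∈ bullHeads G y a n w)
    (hr : r ∈ bullHeads G y a n w) (hpq : G.Adj p q) (hqr : G.Adj q r) (hpr : p ≠ r) :
    G.Adj p r := by
  by_contra hnpr
  set M := component G (bullHeads G y a n w) q
  have hMX : M ⊆ bullHeads G y a n w := component_subset hq
  have hpM : p ∈ M := mem_component_of_adj (mem_component_self _ q) hpq.symm hp
  have hrM : r ∈ M := mem_component_of_adj (mem_component_self _ q) hqr hr
  have hAM : component Gᶜ M p ⊆ M := component_subset hpM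
  have hrA : r ∈ component Gᶜ M p :=
    mem_component_of_adj (mem_component_self M p) ⟨hpr, hnpr⟩ hrM
  have haA : a ∉ component Gᶜ M p := fun h => G.irrefl (hMX (hAM h)).1
  obtain ⟨x, hxM, k, hk, m, hm, hkm, hxk, hxm⟩ :=
    hP.compl.exists_splits_component_edge hrA hpr haA
  replace hm := hAM hm
  replace hk := hAM hk
  have hxm' : G.Adj x m := by
    by_contra h
    exact hxm ⟨fun e => hxM (e ▸ hm), h⟩
  obtain ⟨u, hu, v, hv, huv, hxu, hxv⟩ :=
    component_exists_edge (P := (G.Adj x ·)) hm hk hxm' hxk.2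
  exact hxM (mem_component_of_adj hu hxu.symm (hG.mem_bullHeads hpath (hMX hm) (hMX hk) (hMX hu)
    (hMX hv) (fun h => hkm.2 h.symm) hxm' hxk.2 huv hxu hxv))

/-- The induced diamond with middle vertices `a, b` and ends `c, d`. -/
def IsDiamond (G : SimpleGraph V) (a b c d : V) : Prop :=
  G.Adj a b ∧ G.Adj a c ∧ G.Adj a d ∧ G.Adj b c ∧ G.Adj b d ∧ ¬G.Adj c d ∧ c ≠ d

/-- `v` is adjacent to each of `a, b, c, d`. -/
def AdjAll (G : SimpleGraph V) (v a b c d : V) : Prop :=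
  G.Adj v a ∧ G.Adj v b ∧ G.Adj v c ∧ G.Adj v d

/-- `v` is adjacent to none of `a, b, c, d`. -/
def AdjNone (G : SimpleGraph V) (v a b c d : V) : Prop :=
  ¬G.Adj v a ∧ ¬G.Adj v b ∧ ¬G.Adj v c ∧ ¬G.Adj v d

theorem ForkKiteFree.adj_middle_of_splits_ends (hG : ForkKiteFree G) {a b c d w t : V}
    (hD : IsDiamond G a b c d) (hw : AdjNone G w a b c d) (htc : G.Adj t c) (htd : ¬G.Adj t d) :
    ¬G.Adj t w ∧ (G.Adj t a ∨ G.Adj t b) := by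
  have hmiddle : G.Adj t a ∨ G.Adj t b := by
    grind [IsDiamond, G.adj_comm, hG.kite a b d c t]
  refine ⟨fun htw => ?_, hmiddle⟩
  grind [IsDiamond, AdjNone, G.adj_comm, hG.kite a c b t w, hG.kite b c a t w, hG.kite a b d t w]

theorem IsPrime.exists_splits_ends (hP : IsPrime G) (hG : ForkKiteFree G) {a b c d w : V}
    (hD : IsDiamond G a b c d) (hw : AdjNone G w a b c d) :
    ∃ t, (G.Adj t c ↔ ¬G.Adj t d) ∧ ¬G.Adj t w ∧ (G.Adj t a ∨ G.Adj t b) := by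
  obtain ⟨t, -, -, ht⟩ := hP.exists_adj_iff_not_adj hD.2.2.2.2.2.2 hD.2.1.ne hD.2.2.1.ne
  refine ⟨t, ht, ?_⟩
  by_cases htc : G.Adj t c
  · exact hG.adj_middle_of_splits_ends hD hw htc (ht.1 htc)
  · have hD' : IsDiamond G a b d c := by grind [IsDiamond, G.adj_comm]
    exact hG.adj_middle_of_splits_ends hD' (by grind [AdjNone]) (by grind) htc

theorem IsPrime.adjAll_or_adjNone_of_adj (hP : IsPrime G) (hG : ForkKiteFree G) {a b c d w v : V}
    (hD : IsDiamond G a b c d) (hw : AdjNone G w a b c d) (hwv : G.Adj w v) :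
    AdjAll G v a b c d ∨ AdjNone G v a b c d := by
  have hmiddle : G.Adj v a ∨ G.Adj v b → AdjAll G v a b c d := by
    grind [IsDiamond, AdjAll, AdjNone, G.adj_comm, hG.fork c a v w d, hG.kite a c b v w,
      hG.kite a d b v w, hG.kite a b c v w, hG.kite a b d v w, hG.fork c b v w d,
      hG.kite b c a v w, hG.kite b d a v w]
  by_contra hv
  have hvab : ¬(G.Adj v a ∨ G.Adj v b) := fun h => hv (.inl (hmiddle h))
  have hends : G.Adj v c ∧ G.Adj v d := by
    grind [IsDiamond, AdjNone, G.adj_comm, hG.kite a b d c v, hG.kite a b c d v]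
  obtain ⟨t, ht, htw, hta | htb⟩ := hP.exists_splits_ends hG hD hw
  · grind [IsDiamond, AdjNone, G.adj_comm, hG.fork d v c t w, hG.kite c t a v w,
      hG.fork c v d t w, hG.kite d t a v w]
  · grind [IsDiamond, AdjNone, G.adj_comm, hG.fork d v c t w, hG.kite c t b v w,
      hG.fork c v d t w, hG.kite d t b v w]

theorem IsPrime.adjNone_of_not_adj_edge (hP : IsPrime G) (hG : ForkKiteFree G) {a b c d n w z : V}
    (hD : IsDiamond G a b c d) (hw : AdjNone G w a b c d) (hn : AdjAll G n a b c d)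
    (hnw : G.Adj n w) (hzn : ¬G.Adj z n) (hzw : ¬G.Adj z w) : AdjNone G z a b c d := by
  have hmiddle {a b : V} (hD : IsDiamond G a b c d) (hw : AdjNone G w a b c d)
      (hn : AdjAll G n a b c d) : ¬G.Adj z a := by
    intro hza
    have hzb : ¬G.Adj z b := by grind [IsDiamond, AdjAll, AdjNone, G.adj_comm, hG.kite a b z n w]
    have hzc : ¬G.Adj z c := by grind [IsDiamond, AdjAll, AdjNone, G.adj_comm, hG.kite a c z n w]
    have hzd : ¬G.Adj z d := by grind [IsDiamond, AdjAll, AdjNone, G.adj_comm, hG.kite a d z n w]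
    have htrans := hP.bullHeads_adj_trans hG (y := w) (a := n) (n := a) (w := z)
      (p := c) (q := b) (r := d)
    grind [IsDiamond, AdjAll, AdjNone, IsInducedP4, bullHeads, G.adj_comm]
  have hza := hmiddle hD hw hn
  have hzb : ¬G.Adj z b := hmiddle (a := b) (b := a) (by grind [IsDiamond, G.adj_comm])
    (by grind [AdjNone]) (by grind [AdjAll])
  by_contra hz
  have hends : G.Adj z c ∧ G.Adj z d := by
    grind [IsDiamond, AdjNone, G.adj_comm, hG.kite a b c d z, hG.kite a b d c z]
  obtain ⟨t, ht, htw, -⟩ := hP.exists_splits_ends hG hD hw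
  grind [IsDiamond, AdjAll, AdjNone, G.adj_comm, hG.fork d n c t w, hG.fork t n d z w,
    hG.kite c t z n w, hG.fork c n d t w, hG.fork t n c z w, hG.kite d t z n w]

theorem IsPrime.adj_iff_of_not_adjNone (hP : IsPrime G) (hG : ForkKiteFree G) {a b c d n w x z : V}
    (hD : IsDiamond G a b c d) (hw : AdjNone G w a b c d) (hn : AdjAll G n a b c d)
    (hnw : G.Adj n w) (hzn : G.Adj z n → G.Adj z w) (hxn : G.Adj x n) (hxw : ¬G.Adj x w)
    (hx : ¬AdjNone G x a b c d) : G.Adj z x ↔ G.Adj z a := by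
  by_cases hz : AdjNone G z a b c d
  · refine iff_of_false (fun hzx => ?_) hz.1
    have hxD : AdjAll G x a b c d := (hP.adjAll_or_adjNone_of_adj hG hD hz hzx).resolve_right hx
    have htrans := hP.bullHeads_adj_trans hG (y := w) (a := n) (n := x) (w := z)
      (p := c) (q := a) (r := d)
    grind [IsDiamond, AdjAll, AdjNone, IsInducedP4, bullHeads, G.adj_comm, hG.fork c x z w d]
  · have hzw : G.Adj z w := by
      by_contra hzw
      exact hz (hP.adjNone_of_not_adj_edge hG hD hw hn hnw (mt hzn hzw) hzw)
    have hzD := (hP.adjAll_or_adjNone_of_adj hG hD hw hzw.symm).resolve_right hz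
    refine iff_of_true (by_contra fun hzx => hx ?_) hzD.1
    exact hP.adjNone_of_not_adj_edge hG hD hw hzD hzw (fun h => hzx h.symm) hxw

/-- The vertices adjacent to `n` but not to `w`. -/
def privateNbrs (G : SimpleGraph V) (n w : V) : Set V :=
  {v | G.Adj v n ∧ ¬G.Adj v w}

/-- `v` has a neighbour in a diamond contained in `X` one of whose middle vertices is adjacent to
`z` exactly if `ε` holds. -/
def TouchesDiamond (G : SimpleGraph V) (X : Set V) (z : V) (ε : Prop) (v : V) : Prop :=
  ∃ a b c d, IsDiamond G a b c d ∧ (a ∈ X ∧ b ∈ X ∧ c ∈ X ∧ d ∈ X) ∧ ¬AdjNone G v a b c d ∧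
    (G.Adj z a ↔ ε)

theorem TouchesDiamond.adj_iff {n w z x : V} {ε : Prop}
    (hx : TouchesDiamond G (privateNbrs G n w) z ε x) (hP : IsPrime G) (hG : ForkKiteFree G)
    (hnw : G.Adj n w) (hz : z ∉ privateNbrs G n w) (hxX : x ∈ privateNbrs G n w) :
    G.Adj z x ↔ ε := by
  obtain ⟨a, b, c, d, hD, hDX, hxD, hza⟩ := hx
  simp only [privateNbrs, Set.mem_ofPred_eq] at *
  rw [← hza]
  exact hP.adj_iff_of_not_adjNone hG hD (w := w) (n := n) (by grind [AdjNone, G.adj_comm])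
    (by grind [AdjAll, G.adj_comm]) hnw (by tauto) hxX.1 hxX.2 hxD

theorem TouchesDiamond.of_adj {n w z u x : V} {ε : Prop}
    (hu : TouchesDiamond G (privateNbrs G n w) z ε u) (hP : IsPrime G) (hG : ForkKiteFree G)
    (hnw : G.Adj n w) (hz : z ∉ privateNbrs G n w) (huX : u ∈ privateNbrs G n w)
    (hux : G.Adj u x) : TouchesDiamond G (privateNbrs G n w) z ε x := by
  have hzu := hu.adj_iff hP hG hnw hz huX
  obtain ⟨a, b, c, d, hD, hDX, huD, hza⟩ := hu
  by_cases hx : AdjNone G x a b c d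
  · have huall := (hP.adjAll_or_adjNone_of_adj hG hD hx hux.symm).resolve_right huD
    exact ⟨u, b, c, d, by grind [IsDiamond, AdjAll], by tauto,
      by grind [AdjNone, G.adj_comm], hzu⟩
  · exact ⟨a, b, c, d, hD, hDX, hx, hza⟩

theorem IsPrime.not_adjNone_of_isDiamond (hP : IsPrime G) (hG : ForkKiteFree G) {a b c d w : V}
    (hD : IsDiamond G a b c d) : ¬AdjNone G w a b c d := by
  intro hw'
  obtain ⟨hab, hac, -, hbc, -⟩ := id hD
  obtain ⟨w, hw, n, hnw, hn⟩ :
      ∃ w, AdjNone G w a b c d ∧ ∃ n, G.Adj n w ∧ AdjAll G n a b c d := by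
    have hwa : w ∈ component G Set.univ a := by
      simp only [hP.component_univ hab.ne hac.ne hbc.ne, Set.mem_univ]
    obtain ⟨p, -, q, -, hpq, hp, hq⟩ := component_exists_edge (P := (AdjNone G · a b c d))
      hwa (mem_component_self _ a) hw' (fun h => h.2.1 hab)
    exact ⟨p, hp, q, hpq.symm, (hP.adjAll_or_adjNone_of_adj hG hD hp hpq).resolve_right hq⟩
  have hDX : a ∈ privateNbrs G n w ∧ b ∈ privateNbrs G n w ∧ c ∈ privateNbrs G n w ∧
      d ∈ privateNbrs G n w := by
    simp only [privateNbrs, Set.mem_ofPred_eq]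
    grind [AdjAll, AdjNone, G.adj_comm]
  have hsub := component_subset (G := G) hDX.1
  have hbC : b ∈ component G (privateNbrs G n w) a :=
    mem_component_of_adj (mem_component_self _ a) hab hDX.2.1
  have hnC : n ∉ component G (privateNbrs G n w) a := fun h => G.irrefl (hsub h).1
  obtain ⟨z, hz, p, hp, q, hq, -, hzp, hzq⟩ :=
    hP.exists_splits_component_edge hbC hab.ne hnC
  have htouch : ∀ x ∈ component G (privateNbrs G n w) a,
      TouchesDiamond G (privateNbrs G n w) z (G.Adj z a) x :=
    component_induction ⟨a, b, c, d, hD, hDX, fun h => h.2.1 hab, Iff.rfl⟩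
      fun u hu v _ huv ih => ih.of_adj hP hG hnw hz (hsub hu) huv
  have hconst : ∀ x ∈ component G (privateNbrs G n w) a, (G.Adj z x ↔ G.Adj z a) :=
    fun x hx => (htouch x hx).adj_iff hP hG hnw hz (hsub hx)
  exact hzq ((hconst q hq).2 ((hconst p hp).1 hzp))

theorem IsPrime.not_adjAll_of_isDiamond_compl (hP : IsPrime G) (hG : ForkKiteFree G)
    {a b c d w : V} (hD : IsDiamond Gᶜ a b c d) : ¬AdjAll G w a b c d := by
  have h := hP.compl.not_adjNone_of_isDiamond hG.compl hD (w := w)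
  grind [AdjAll, AdjNone, SimpleGraph.compl_adj]

/-- A triangle `a, b, c` together with a vertex `w` adjacent to none of them. -/
def IsCoclaw (G : SimpleGraph V) (a b c w : V) : Prop :=
  G.Adj a b ∧ G.Adj a c ∧ G.Adj b c ∧ ¬G.Adj w a ∧ ¬G.Adj w b ∧ ¬G.Adj w c

theorem IsPrime.adj_of_isCoclaw_of_adjAll (hP : IsPrime G) (hG : ForkKiteFree G) {a b c w n p : V}
    (hT : IsCoclaw G a b c w) (hn : AdjAll G n a b c w) (hnp : G.Adj n p) (hpa : G.Adj p a)
    (hpb : ¬G.Adj p b) (hpc : ¬G.Adj p c) : G.Adj p w := by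
  by_contra hpw
  have hD : IsDiamond Gᶜ w p b c → ¬AdjAll G n w p b c := hP.not_adjAll_of_isDiamond_compl hG
  grind [IsCoclaw, AdjAll, IsDiamond, SimpleGraph.compl_adj, G.adj_comm, G.ne_of_adj]

theorem IsPrime.adj_or_adj_of_isCoclaw (hP : IsPrime G) (hG : ForkKiteFree G)
    {a b c w n p z : V} (hT : IsCoclaw G a b c w) (hn : AdjAll G n a b c w) (hnp : G.Adj n p)
    (hpa : G.Adj p a) (hpb : ¬G.Adj p b) (hpc : ¬G.Adj p c) (hpw : G.Adj p w) (hzn : ¬G.Adj z n)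
    (hza : G.Adj z a) : G.Adj z b ∨ G.Adj z c := by
  by_contra! hz
  obtain ⟨t, hneb, hnec, ht⟩ := hP.exists_adj_iff_not_adj hT.2.2.1.ne hT.1.ne hT.2.1.ne
  have hsplit {b c : V} (hT : IsCoclaw G a b c w) (hn : AdjAll G n a b c w) (hpb : ¬G.Adj p b)
      (hpc : ¬G.Adj p c) (hzb : ¬G.Adj z b) (hzc : ¬G.Adj z c) (hne : t ≠ c)
      (htb : G.Adj t b) (htc : ¬G.Adj t c) : False := by
    by_cases hta : G.Adj t a
    · grind [IsCoclaw, AdjAll, G.adj_comm, G.ne_of_adj, hG.fork c a p w t, hG.kite a b c t w,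
        hG.kite a t b p w]
    · grind [IsCoclaw, AdjAll, G.adj_comm, G.ne_of_adj, hG.kite a n p b t, hG.kite b n t a z,
        hG.kite a n c p t, hG.kite b n c t z]
  by_cases htb : G.Adj t b
  · exact hsplit hT hn hpb hpc hz.1 hz.2 hnec htb (ht.1 htb)
  · exact hsplit (by grind [IsCoclaw, G.adj_comm]) (by grind [AdjAll]) hpc hpb hz.2 hz.1 hneb
      (by grind) htb

theorem IsPrime.adjAll_or_adjNone_of_isCoclaw (hP : IsPrime G) (hG : ForkKiteFree G)
    {a b c w n p z : V} (hT : IsCoclaw G a b c w) (hn : AdjAll G n a b c w) (hnp : G.Adj n p)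
    (hpa : G.Adj p a) (hpb : ¬G.Adj p b) (hpc : ¬G.Adj p c) (hzn : ¬G.Adj z n) :
    AdjAll G z a b w p ∨ AdjNone G z a b w p := by
  have hpw := hP.adj_of_isCoclaw_of_adjAll hG hT hn hnp hpa hpb hpc
  by_cases hzp : G.Adj z p
  · have hza : G.Adj z a := by
      grind [IsCoclaw, AdjAll, G.adj_comm, hG.kite a n b p z, hG.kite a n c p z,
        hG.kite b c z n w, hG.kite b c a z w]
    have hbc := hP.adj_or_adj_of_isCoclaw hG hT hn hnp hpa hpb hpc hpw hzn hza
    grind [IsCoclaw, AdjAll, G.adj_comm, hG.kite a b z n w, hG.kite a b z p w, hG.kite a c z n w,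
      hG.kite a c z p w, hG.kite a c b z w]
  · have hza : ¬G.Adj z a := by
      intro hza
      have hD : IsDiamond Gᶜ p z b c → ¬AdjAll G a p z b c := hP.not_adjAll_of_isDiamond_compl hG
      have hzbc : G.Adj z b ∨ G.Adj z c := by
        grind [IsCoclaw, AdjAll, IsDiamond, SimpleGraph.compl_adj, G.adj_comm, G.ne_of_adj]
      grind [IsCoclaw, AdjAll, G.adj_comm, G.ne_of_adj, hG.fork c a p w z, hG.fork b a p w z,
        hG.kite b c z n p, hG.kite a b c z w, hG.kite a c b z w]
    grind [IsCoclaw, AdjAll, AdjNone, G.adj_comm, G.ne_of_adj, hG.kite a n p b z,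
      hG.kite n p w a z, hG.kite p n a w z]

/-- A triangle `a, b, c` with private neighbours `p, x, y` of its vertices such that `x` and `y` are
nonadjacent neighbours of `p`. -/
structure IsClawOverTriangle (G : SimpleGraph V) (a b c p x y : V) : Prop where
  triangle : G.Adj a b ∧ G.Adj a c ∧ G.Adj b c
  center : G.Adj p a ∧ ¬G.Adj p b ∧ ¬G.Adj p c
  left : G.Adj x b ∧ ¬G.Adj x a ∧ ¬G.Adj x c
  right : G.Adj y c ∧ ¬G.Adj y a ∧ ¬G.Adj y b
  leaves : G.Adj p x ∧ G.Adj p y ∧ ¬G.Adj x y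

theorem IsClawOverTriangle.not_adj_of_isCoclaw (hG : ForkKiteFree G) {a b c w p x y : V}
    (h : IsClawOverTriangle G a b c p x y) (hT : IsCoclaw G a b c w) :
    ¬G.Adj w p ∧ ¬G.Adj w x ∧ ¬G.Adj w y := by
  obtain ⟨-, hp, hx, hy, hxy⟩ := h
  have hwx : ¬G.Adj w x := by
    grind [IsCoclaw, G.adj_comm, G.ne_of_adj, hG.fork p x b c w, hG.fork w p a b y,
      hG.kite p w x y c]
  have hwy : ¬G.Adj w y := by
    grind [IsCoclaw, G.adj_comm, G.ne_of_adj, hG.fork p y c b w, hG.fork w p a c x,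
      hG.kite p w x y c]
  grind [IsCoclaw, G.adj_comm, G.ne_of_adj, hG.fork w p a b y]

theorem IsClawOverTriangle.not_attached_of_adj (hG : ForkKiteFree G) {a b c w p x y t : V}
    (h : IsClawOverTriangle G a b c p x y) (hT : IsCoclaw G a b c w) (htw : G.Adj t w) :
    ¬(G.Adj t a ∧ ¬G.Adj t b ∧ ¬G.Adj t c) ∧ ¬(¬G.Adj t a ∧ G.Adj t b ∧ ¬G.Adj t c) ∧
      ¬(¬G.Adj t a ∧ ¬G.Adj t b ∧ G.Adj t c) := by
  have hw := h.not_adj_of_isCoclaw hG hT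
  obtain ⟨-, hp, hx, hy, hxy⟩ := h
  refine ⟨fun ht => ?_, fun ht => ?_, fun ht => ?_⟩
  · grind [IsCoclaw, G.adj_comm, G.ne_of_adj, hG.fork b a p y t, hG.fork x p t w y,
      hG.fork w t a c x, hG.fork w t a b y]
  · grind [IsCoclaw, G.adj_comm, G.ne_of_adj, hG.fork a b t w x, hG.fork a p x t y,
      hG.fork a p t w y, hG.fork w t b a y]
  · grind [IsCoclaw, G.adj_comm, G.ne_of_adj, hG.fork a c t w y, hG.fork a p y t x,
      hG.fork a p t w x, hG.fork w t c a x]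

/-- `S` splits the neighbours of `v` into two cliques with no edges between them: the neighbours in
`S` and those outside it. -/
def IsCliqueSplit (G : SimpleGraph V) (v : V) (S : Set V) : Prop :=
  ∀ x y, G.Adj v x → G.Adj v y → x ≠ y → (G.Adj x y ↔ (x ∈ S ↔ y ∈ S))

/-- The neighbourhood of `v` is a disjoint union of two cliques, possibly empty, with no edges
between them. -/
def TwoCliques (G : SimpleGraph V) (v : V) : Prop :=
  ∃ S, IsCliqueSplit G v S

/-- `v` is the centre of an induced claw with leaves `x, y, z`. -/
def IsClaw (G : SimpleGraph V) (v x y z : V) : Prop :=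
  (G.Adj v x ∧ G.Adj v y ∧ G.Adj v z) ∧ (x ≠ y ∧ x ≠ z ∧ y ≠ z) ∧
    ¬G.Adj x y ∧ ¬G.Adj x z ∧ ¬G.Adj y z

theorem TwoCliques.not_isClaw {v x y z : V} (h : TwoCliques G v) : ¬IsClaw G v x y z := by
  rintro ⟨⟨hx, hy, hz⟩, ⟨hxy, hxz, hyz⟩, hn⟩
  obtain ⟨S, h⟩ := h
  have := h x y hx hy hxy
  have := h x z hx hz hxz
  have := h y z hy hz hyz
  tauto

theorem TwoCliques.adj_trans {v x y z : V} (h : TwoCliques G v) (hx : G.Adj v x) (hy : G.Adj v y)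
    (hz : G.Adj v z) (hxz : x ≠ z) (hxy : G.Adj x y) (hyz : G.Adj y z) : G.Adj x z := by
  obtain ⟨S, h⟩ := h
  have := h x y hx hy hxy.ne
  have := h x z hx hz hxz
  have := h y z hy hz hyz.ne
  tauto

theorem TwoCliques.of_partition {v : V} (S : Set V)
    (hinside : ∀ x ∈ S, ∀ y ∈ S, G.Adj v x → G.Adj v y → x ≠ y → G.Adj x y)
    (houtside : ∀ x ∉ S, ∀ y ∉ S, G.Adj v x → G.Adj v y → x ≠ y → G.Adj x y)
    (hacross : ∀ x ∈ S, ∀ y ∉ S, G.Adj v x → G.Adj v y → ¬G.Adj x y) : TwoCliques G v :=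
  ⟨S, by grind [IsCliqueSplit, G.adj_comm]⟩

theorem TwoCliques.of_adj (hG : ForkKiteFree G) {p w : V} (hp : TwoCliques G p) (hpw : G.Adj p w)
    (hmiss : ∀ x y, G.Adj w x → G.Adj w y → ¬G.Adj p x → ¬G.Adj p y → x ≠ p → y ≠ p →
      ¬G.Adj x y → ∃ r, G.Adj p r ∧ ¬G.Adj r w ∧ r ≠ w ∧ ¬G.Adj r x ∧ ¬G.Adj r y) :
    TwoCliques G w := by
  refine .of_partition {x | x = p ∨ G.Adj p x} ?_ ?_ ?_
  · rintro x (rfl | hpx) y (rfl | hpy) hwx hwy hxy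
    · exact absurd rfl hxy
    · exact hpy
    · exact hpx.symm
    · exact hp.adj_trans hpx hpw hpy hxy hwx.symm hwy
  · intro x hxS y hyS hwx hwy hxy
    by_contra hnxy
    obtain ⟨hxp, hpx⟩ := not_or.1 hxS
    obtain ⟨hyp, hpy⟩ := not_or.1 hyS
    obtain ⟨r, hpr, hrw, -, hrx, hry⟩ := hmiss x y hwx hwy hpx hpy hxp hyp hnxy
    grind [G.adj_comm, hG.fork x w p r y]
  · rintro x (rfl | hpx) y hyS hwx hwy hxy
    · exact hyS (.inr hxy)
    · obtain ⟨hyp, hpy⟩ := not_or.1 hyS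
      obtain ⟨r, hpr, hrw, hne, hry, -⟩ := hmiss y y hwy hwy hpy hpy hyp hyp G.irrefl
      have hrx : ¬G.Adj r x := fun h => hrw (hp.adj_trans hpr hpx hpw hne h hwx.symm)
      grind [G.adj_comm, hG.kite w x y p r]

/-- `n` is an outside vertex complete to `K`. -/
def Dominates (G : SimpleGraph V) (K : Set V) (n : V) : Prop :=
  n ∉ K ∧ ∀ x ∈ K, G.Adj n x

/-- `w` is anticomplete to `K`. -/
def Avoids (G : SimpleGraph V) (K : Set V) (w : V) : Prop :=
  ∀ x ∈ K, ¬G.Adj w x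

/-- `a` is the only neighbour of `v` in `K`. -/
def AttachedAt (G : SimpleGraph V) (K : Set V) (v a : V) : Prop :=
  a ∈ K ∧ G.Adj v a ∧ ∀ x ∈ K, x ≠ a → ¬G.Adj v x

/-- A clique with at least three vertices avoided by some vertex, such that each vertex dominating
it is adjacent to all vertices avoiding it. -/
structure IsTopClique (G : SimpleGraph V) (K : Set V) : Prop where
  isClique : G.IsClique K
  exists_ne_ne : ∀ x y, ∃ c ∈ K, c ≠ x ∧ c ≠ y
  exists_avoids : ∃ w, Avoids G K w
  adj_of_dominates : ∀ ⦃n⦄, Dominates G K n → ∀ ⦃w⦄, Avoids G K w → G.Adj n w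

theorem IsCoclaw.exists_isTopClique [Finite V] {a b c w : V} (h : IsCoclaw G a b c w) :
    ∃ K, IsTopClique G K := by
  obtain ⟨hab, hac, hbc, hw⟩ := h
  let F : Set (Set V) := {K | {a, b, c} ⊆ K ∧ G.IsClique K ∧ ∃ w, Avoids G K w}
  have hT : {a, b, c} ∈ F := by
    refine ⟨subset_rfl, by simp [SimpleGraph.isClique_insert, hab, hac, hbc], w, ?_⟩
    simpa [Avoids] using hw
  obtain ⟨K, -, ⟨hTK, hK, hw⟩, hmax⟩ := (Set.toFinite F).exists_le_maximal hT
  simp only [Set.insert_subset_iff, Set.singleton_subset_iff] at hTK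
  refine ⟨K, hK, fun x y => ?_, hw, fun n hn w hw => by_contra fun hnw => ?_⟩
  · by_contra! hfew
    have hax := hfew a hTK.1
    have hbx := hfew b hTK.2.1
    have hcx := hfew c hTK.2.2
    grind +splitImp [G.ne_of_adj]
  · refine hn.1 (hmax (y := insert n K) ⟨?_, hK.insert fun x hx _ => hn.2 x hx, w, ?_⟩
      (Set.subset_insert n K) (Set.mem_insert n K))
    · simp [Set.insert_subset_iff, hTK]
    · rintro x (rfl | hx)
      · exact fun h => hnw h.symm
      · exact hw x hx

namespace IsTopClique

variable {K : Set V}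

theorem exists_edge_avoiding (hK : IsTopClique G K) (a : V) :
    ∃ b ∈ K, ∃ c ∈ K, b ≠ a ∧ c ≠ a ∧ G.Adj b c := by
  obtain ⟨b, hb, hba, -⟩ := hK.exists_ne_ne a a
  obtain ⟨c, hc, hca, hcb⟩ := hK.exists_ne_ne a b
  exact ⟨b, hb, c, hc, hba, hca, hK.isClique hb hc hcb.symm⟩

theorem notMem_of_attachedAt (hK : IsTopClique G K) {v a : V} (h : AttachedAt G K v a) : v ∉ K := by
  intro hv
  obtain ⟨c, hc, hca, hcv⟩ := hK.exists_ne_ne a v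
  exact h.2.2 c hc hca (hK.isClique hv hc hcv.symm)

theorem notMem_of_avoids (hK : IsTopClique G K) {w : V} (h : Avoids G K w) : w ∉ K := by
  intro hw
  obtain ⟨c, hc, hcw, -⟩ := hK.exists_ne_ne w w
  exact h c hc (hK.isClique hw hc hcw.symm)

theorem dominates_or_attachedAt_or_avoids (hK : IsTopClique G K) (hP : IsPrime G)
    (hG : ForkKiteFree G) {v : V} (hv : v ∉ K) :
    Dominates G K v ∨ (∃ a, AttachedAt G K v a) ∨ Avoids G K v := by
  by_contra! hcon
  simp only [Dominates, AttachedAt, Avoids, not_and, not_forall, not_not] at hcon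
  obtain ⟨hdom, hatt, a, ha, hva⟩ := hcon
  obtain ⟨c, hc, hvc⟩ := hdom hv
  obtain ⟨b, hb, hba, hvb⟩ := hatt a ha hva
  obtain ⟨w, hw⟩ := hK.exists_avoids
  have hab := hK.isClique ha hb hba.symm
  have hac := hK.isClique ha hc (by grind)
  have hbc := hK.isClique hb hc (by grind)
  have hD : IsDiamond G a b c v := by grind [IsDiamond, G.adj_comm]
  have hwv : G.Adj w v := by
    have := hP.not_adjNone_of_isDiamond hG hD (w := w)
    grind [AdjNone, Avoids]
  grind [Avoids, G.adj_comm, hG.kite a b c v w]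

theorem adjAll_or_adjNone_of_not_adj (hK : IsTopClique G K) (hP : IsPrime G) (hG : ForkKiteFree G)
    {n p a b w v : V} (hn : Dominates G K n) (hp : AttachedAt G K p a) (hnp : G.Adj n p)
    (hb : b ∈ K) (hba : b ≠ a) (hw : Avoids G K w) (hvn : ¬G.Adj v n) :
    AdjAll G v a b w p ∨ AdjNone G v a b w p := by
  obtain ⟨c, hc, hca, hcb⟩ := hK.exists_ne_ne a b
  obtain ⟨ha, hpa, hpK⟩ := hp
  exact hP.adjAll_or_adjNone_of_isCoclaw hG
    ⟨hK.isClique ha hb hba.symm, hK.isClique ha hc hca.symm, hK.isClique hb hc hcb.symm,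
      hw a ha, hw b hb, hw c hc⟩
    ⟨hn.2 a ha, hn.2 b hb, hn.2 c hc, hK.adj_of_dominates hn hw⟩ hnp hpa (hpK b hb hba)
    (hpK c hc hca) hvn

end IsTopClique

/-- The neighbours of `n` with exactly one neighbour in `K`. -/
def attachedNbrs (G : SimpleGraph V) (K : Set V) (n : V) : Set V :=
  {q | (∃ d, AttachedAt G K q d) ∧ G.Adj n q}

/-- The set that turns out to be a module if `n` dominates `K` and has a neighbour attached to `K`:
the clique `K`, the vertices avoiding it, the neighbours of `n` attached to it, and the dominating
neighbours of `n` missing one of the latter. -/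
def dominatedHull (G : SimpleGraph V) (K : Set V) (n : V) : Set V :=
  K ∪ {w | Avoids G K w} ∪ attachedNbrs G K n ∪
    {m | Dominates G K m ∧ G.Adj n m ∧ ∃ q ∈ attachedNbrs G K n, ¬G.Adj m q}

namespace IsTopClique

variable {K : Set V}

theorem adj_of_adj_of_notMem_dominatedHull (hK : IsTopClique G K) (hP : IsPrime G)
    (hG : ForkKiteFree G) {n v x : V} (hvn : G.Adj n v) (hv : v ∉ dominatedHull G K n)
    (hx : x ∈ dominatedHull G K n) : G.Adj v x := by
  simp only [dominatedHull, Set.mem_union, Set.mem_ofPred_eq, not_or] at hv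
  obtain ⟨⟨⟨hvK, hvavoids⟩, hvatt⟩, hvmiss⟩ := hv
  have hvdom : Dominates G K v :=
    (hK.dominates_or_attachedAt_or_avoids hP hG hvK).resolve_right fun h =>
      h.elim (fun h => hvatt ⟨h, hvn⟩) hvavoids
  have hvatt' : ∀ q ∈ attachedNbrs G K n, G.Adj v q := fun q hq => by_contra fun h =>
    hvmiss ⟨hvdom, hvn, q, hq, h⟩
  rcases hx with ((hx | hx) | hx) | ⟨hxdom, -, q, hq, hxq⟩
  · exact hvdom.2 x hx
  · exact hK.adj_of_dominates hvdom hx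
  · exact hvatt' x hx
  · have hvq := hvatt' q hq
    obtain ⟨⟨d, -, -, hqK⟩, -⟩ := hq
    obtain ⟨b, hb, c, hc, hbd, hcd, hbc⟩ := hK.exists_edge_avoiding d
    grind [Dominates, G.adj_comm, hG.kite b c x v q]

theorem adj_iff_of_not_adj_of_mem_dominatedHull (hK : IsTopClique G K) (hP : IsPrime G)
    (hG : ForkKiteFree G) {n p a v x : V} (hn : Dominates G K n) (hp : AttachedAt G K p a)
    (hnp : G.Adj n p) (hvn : ¬G.Adj v n) (hx : x ∈ dominatedHull G K n) :
    G.Adj v a ↔ G.Adj v x := by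
  obtain ⟨w, hw⟩ := hK.exists_avoids
  have hclique : ∀ b ∈ K, (G.Adj v a ↔ G.Adj v b) := by
    intro b hb
    rcases eq_or_ne b a with rfl | hba
    · rfl
    · have := hK.adjAll_or_adjNone_of_not_adj hP hG hn hp hnp hb hba hw hvn
      grind [AdjAll, AdjNone]
  have hattached : ∀ q ∈ attachedNbrs G K n, (G.Adj v a ↔ G.Adj v q) := by
    rintro q ⟨⟨d, hqd⟩, hnq⟩
    obtain ⟨b, hb, hbd, -⟩ := hK.exists_ne_ne d d
    have := hK.adjAll_or_adjNone_of_not_adj hP hG hn hqd hnq hb hbd hw hvn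
    have := hclique d hqd.1
    grind [AdjAll, AdjNone]
  rcases hx with ((hx | hx) | hx) | ⟨hxdom, hnx, q, hq, hxq⟩
  · exact hclique x hx
  · obtain ⟨b, hb, hba, -⟩ := hK.exists_ne_ne a a
    have := hK.adjAll_or_adjNone_of_not_adj hP hG hn hp hnp hb hba hx hvn
    grind [AdjAll, AdjNone]
  · exact hattached x hx
  · have hvq := hattached q hq
    obtain ⟨⟨d, hd, hqd, hqK⟩, hnq⟩ := hq
    obtain ⟨b, hb, c, hc, hbd, hcd, hbc⟩ := hK.exists_edge_avoiding d
    have := hclique b hb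
    have := hclique c hc
    have := hclique d hd
    grind [Dominates, G.adj_comm, hG.kite b c x v q, hG.kite d n q x v]

theorem not_adj_of_dominates_of_attachedAt (hK : IsTopClique G K) (hP : IsPrime G)
    (hG : ForkKiteFree G) {n p a : V} (hn : Dominates G K n) (hp : AttachedAt G K p a) :
    ¬G.Adj n p := by
  intro hnp
  obtain ⟨b, hb, c, hc, -, -, hbc⟩ := hK.exists_edge_avoiding a
  refine hP.not_isModule (X := dominatedHull G K n) (.inl (.inl (.inl hb))) (.inl (.inl (.inl hc)))
    hbc.ne (v := n) ?_ fun x hx y hy v hv hvx => ?_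
  · rintro (((h | h) | h) | h)
    · exact hn.1 h
    · exact h b hb (hn.2 b hb)
    · exact G.irrefl h.2
    · exact G.irrefl h.2.1
  · by_cases hvn : G.Adj n v
    · exact hK.adj_of_adj_of_notMem_dominatedHull hP hG hvn hv hy
    · have hconst {x : V} := hK.adj_iff_of_not_adj_of_mem_dominatedHull hP hG hn hp hnp
        (mt G.adj_symm hvn) (x := x)
      exact (hconst hy).1 ((hconst hx).2 hvx)

theorem eq_of_dominates (hK : IsTopClique G K) (hP : IsPrime G) (hG : ForkKiteFree G) {m n : V}
    (hm : Dominates G K m) (hn : Dominates G K n) : m = n := by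
  by_contra hmn
  obtain ⟨b, hb, -⟩ := hK.exists_ne_ne m m
  refine hP.not_isModule (X := {v | Dominates G K v}) hm hn hmn (v := b) (fun h => h.1 hb) ?_
  intro x hx y hy v hv hvx
  by_cases hvK : v ∈ K
  · exact (hy.2 v hvK).symm
  rcases hK.dominates_or_attachedAt_or_avoids hP hG hvK with h | ⟨a, h⟩ | h
  · exact absurd h hv
  · exact absurd hvx.symm (hK.not_adj_of_dominates_of_attachedAt hP hG hx h)
  · exact (hK.adj_of_dominates hy h).symm

theorem adj_of_attachedAt (hK : IsTopClique G K) (hP : IsPrime G) (hG : ForkKiteFree G)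
    {a p q : V} (hp : AttachedAt G K p a) (hq : AttachedAt G K q a) (hpq : p ≠ q) :
    G.Adj p q := by
  by_contra hnpq
  have hsub : component Gᶜ {v | AttachedAt G K v a} p ⊆ {v | AttachedAt G K v a} :=
    component_subset hp
  have hqC : q ∈ component Gᶜ {v | AttachedAt G K v a} p :=
    mem_component_of_adj (mem_component_self _ p) ⟨hpq, hnpq⟩ hq
  obtain ⟨v, hv, r, hr, s, hs, hrs, hvr, hvs⟩ := hP.compl.exists_splits_component_edge hqC hpq
    (fun h => hK.notMem_of_attachedAt (hsub h) hp.1)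
  replace hr := hsub hr
  replace hs := hsub hs
  have hvs' : G.Adj v s := by
    by_contra h
    exact hvs ⟨fun e => hv (e ▸ hs), h⟩
  have hvK : v ∉ K := by
    intro hvK
    have : v = a := by_contra fun hva => hs.2.2 v hvK hva hvs'.symm
    exact hvr.2 (this ▸ hr.2.1.symm)
  obtain ⟨c, hc, hca, hva, hvc⟩ : ∃ c ∈ K, c ≠ a ∧ ¬G.Adj v a ∧ ¬G.Adj v c := by
    rcases hK.dominates_or_attachedAt_or_avoids hP hG hvK with h | ⟨d, h⟩ | h
    · exact absurd hvs' (hK.not_adj_of_dominates_of_attachedAt hP hG h hs)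
    · have hda : a ≠ d := fun e => hv (e ▸ h)
      obtain ⟨c, hc, hca, hcd⟩ := hK.exists_ne_ne a d
      exact ⟨c, hc, hca, h.2.2 a hp.1 hda, h.2.2 c hc hcd⟩
    · obtain ⟨c, hc, hca, -⟩ := hK.exists_ne_ne a a
      exact ⟨c, hc, hca, h a hp.1, h c hc⟩
  have hac := hK.isClique hp.1 hc hca.symm
  have hrc := hK.notMem_of_attachedAt hr
  have := hr.2.2 c hc hca
  have := hs.2.2 c hc hca
  grind [AttachedAt, G.adj_comm, hG.fork r a s v c, SimpleGraph.compl_adj]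

theorem twoCliques_of_mem (hK : IsTopClique G K) (hP : IsPrime G) (hG : ForkKiteFree G) {a : V}
    (ha : a ∈ K) : TwoCliques G a := by
  have houtside : ∀ x, G.Adj a x → ¬AttachedAt G K x a → x ∈ K ∨ Dominates G K x := by
    intro x hx hxa
    by_cases hxK : x ∈ K
    · exact .inl hxK
    rcases hK.dominates_or_attachedAt_or_avoids hP hG hxK with h | ⟨d, h⟩ | h
    · exact .inr h
    · have hda : a ≠ d := fun e => hxa (e ▸ h)
      exact absurd hx.symm (h.2.2 a ha hda)
    · exact absurd hx.symm (h a ha)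
  refine .of_partition {x | AttachedAt G K x a} ?_ ?_ ?_
  · exact fun x hx y hy _ _ hxy => hK.adj_of_attachedAt hP hG hx hy hxy
  · intro x hx y hy hax hay hxy
    rcases houtside x hax hx with hx | hx <;> rcases houtside y hay hy with hy | hy
    · exact hK.isClique hx hy hxy
    · exact (hy.2 x hx).symm
    · exact hx.2 y hy
    · exact absurd (hK.eq_of_dominates hP hG hx hy) hxy
  · intro x hx y hy _ hay
    rcases houtside y hay hy with hy | hy
    · exact hx.2.2 y hy hay.ne'
    · exact mt G.adj_symm (hK.not_adj_of_dominates_of_attachedAt hP hG hy hx)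

theorem twoCliques_of_dominates (hK : IsTopClique G K) (hP : IsPrime G) (hG : ForkKiteFree G)
    {n : V} (hn : Dominates G K n) : TwoCliques G n := by
  have houtside : ∀ x ∉ K, G.Adj n x → Avoids G K x := by
    intro x hxK hnx
    rcases hK.dominates_or_attachedAt_or_avoids hP hG hxK with h | ⟨d, h⟩ | h
    · exact absurd (hK.eq_of_dominates hP hG hn h) hnx.ne
    · exact absurd hnx (hK.not_adj_of_dominates_of_attachedAt hP hG hn h)
    · exact h
  refine .of_partition K ?_ ?_ ?_
  · exact fun x hx y hy _ _ hxy => hK.isClique hx hy hxy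
  · intro x hx y hy hnx hny hxy
    by_contra hnxy
    obtain ⟨b, hb, c, hc, -, -, hbc⟩ := hK.exists_edge_avoiding n
    have hmiss {u r : V} (hu : u ∉ K) (hnu : G.Adj n u) (hr : r ∈ K) : Gᶜ.Adj u r :=
      ⟨fun e => hu (e ▸ hr), houtside u hu hnu r hr⟩
    exact hP.not_adjAll_of_isDiamond_compl hG
      ⟨⟨hxy, hnxy⟩, hmiss hx hnx hb, hmiss hx hnx hc, hmiss hy hny hb, hmiss hy hny hc,
        fun h => h.2 hbc, hbc.ne⟩ ⟨hnx, hny, hn.2 b hb, hn.2 c hc⟩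
  · exact fun x hx y hy _ hny => mt G.adj_symm (houtside y hy hny x hx)

theorem not_isClawOverTriangle {a b c p x y : V} (hK : IsTopClique G {a, b, c}) (hP : IsPrime G)
    (hG : ForkKiteFree G) : ¬IsClawOverTriangle G a b c p x y := by
  intro h
  obtain ⟨⟨hab, hac, hbc⟩, hp, hx, hy, hxy⟩ := id h
  have hconn (v : V) : v ∈ component G Set.univ a := by
    simp only [hP.component_univ hab.ne hac.ne hbc.ne, Set.mem_univ]
  obtain ⟨w, hw⟩ := hK.exists_avoids
  obtain ⟨w, -, t, -, hwt, hw, ht⟩ :=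
    component_exists_edge (P := Avoids G {a, b, c}) (hconn w) (hconn a) hw
      (fun h => h b (by simp) hab)
  have hT : IsCoclaw G a b c w := ⟨hab, hac, hbc, by simpa [Avoids] using hw⟩
  have hattached := h.not_attached_of_adj hG hT hwt.symm
  rcases hK.dominates_or_attachedAt_or_avoids hP hG (fun htK => hw t htK hwt) with
    htd | ⟨d, hd, htd, htK⟩ | hta
  · have hnt {q d : V} (hq : AttachedAt G {a, b, c} q d) : ¬G.Adj t q :=
      hK.not_adj_of_dominates_of_attachedAt hP hG htd hq
    have htp : ¬G.Adj t p := hnt (d := a) (by simp [AttachedAt]; grind)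
    have htx : ¬G.Adj t x := hnt (d := b) (by simp [AttachedAt]; grind)
    have hty : ¬G.Adj t y := hnt (d := c) (by simp [AttachedAt]; grind)
    have hta : G.Adj t a := htd.2 a (by simp)
    grind [G.adj_comm, hG.fork x p a t y]
  · simp only [Set.mem_insert_iff, Set.mem_singleton_iff, forall_eq_or_imp, forall_eq] at hd htK
    grind [hab.ne, hac.ne, hbc.ne]
  · exact ht hta

theorem eq_of_adj_of_adj (hK : IsTopClique G K) (hP : IsPrime G) (hG : ForkKiteFree G)
    {v a b c : V} (hv : v ∉ K) (ha : a ∈ K) (hva : ¬G.Adj v a) (hb : b ∈ K) (hc : c ∈ K)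
    (hvb : G.Adj v b) (hvc : G.Adj v c) : b = c := by
  rcases hK.dominates_or_attachedAt_or_avoids hP hG hv with h | ⟨d, h⟩ | h
  · exact absurd (h.2 a ha) hva
  · have hbd : b = d := by_contra fun hbd => h.2.2 b hb hbd hvb
    have hcd : c = d := by_contra fun hcd => h.2.2 c hc hcd hvc
    rw [hbd, hcd]
  · exact absurd hvb (h b hb)

theorem exists_isClawOverTriangle (hK : IsTopClique G K) (hP : IsPrime G) (hG : ForkKiteFree G)
    {a p x y : V} (hp : AttachedAt G K p a) (hpx : G.Adj p x) (hpy : G.Adj p y)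
    (hxa : ¬G.Adj x a) (hya : ¬G.Adj y a) (hxK : x ∉ K) (hyK : y ∉ K) (hxy : ¬G.Adj x y)
    (hcover : ∀ r ∈ K, r ≠ a → G.Adj x r ∨ G.Adj y r) :
    ∃ b c, K = {a, b, c} ∧ IsClawOverTriangle G a b c p x y := by
  have hx {b c : V} (hb : b ∈ K) := hK.eq_of_adj_of_adj hP hG hxK hp.1 hxa hb (c := c)
  have hy {b c : V} (hb : b ∈ K) := hK.eq_of_adj_of_adj hP hG hyK hp.1 hya hb (c := c)
  obtain ⟨b, hb, c, hc, hba, hca, hbc, hxb, hyc⟩ :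
      ∃ b ∈ K, ∃ c ∈ K, b ≠ a ∧ c ≠ a ∧ b ≠ c ∧ G.Adj x b ∧ G.Adj y c := by
    obtain ⟨b, hb, c, hc, hba, hca, hbc⟩ := hK.exists_edge_avoiding a
    rcases hcover b hb hba with hxb | hyb <;> rcases hcover c hc hca with hxc | hyc
    · exact absurd (hx hb hc hxb hxc) hbc.ne
    · exact ⟨b, hb, c, hc, hba, hca, hbc.ne, hxb, hyc⟩
    · exact ⟨c, hc, b, hb, hca, hba, hbc.ne', hxc, hyb⟩
    · exact absurd (hy hb hc hyb hyc) hbc.ne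
  refine ⟨b, c, ?_, ⟨hK.isClique hp.1 hb hba.symm, hK.isClique hp.1 hc hca.symm,
    hK.isClique hb hc hbc⟩, ⟨hp.2.1, hp.2.2 b hb hba, hp.2.2 c hc hca⟩,
    ⟨hxb, hxa, fun hxc => hbc (hx hb hc hxb hxc)⟩, ⟨hyc, hya, fun hyb => hbc (hy hb hc hyb hyc)⟩,
    hpx, hpy, hxy⟩
  ext r
  simp only [Set.mem_insert_iff, Set.mem_singleton_iff]
  refine ⟨fun hr => ?_, by rintro (rfl | rfl | rfl) <;> [exact hp.1; exact hb; exact hc]⟩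
  by_contra! h
  rcases hcover r hr h.1 with hxr | hyr
  · exact h.2.1 (hx hr hb hxr hxb)
  · exact h.2.2 (hy hr hc hyr hyc)

theorem twoCliques_of_attachedAt (hK : IsTopClique G K) (hP : IsPrime G) (hG : ForkKiteFree G)
    {a p : V} (hp : AttachedAt G K p a) : TwoCliques G p := by
  refine (hK.twoCliques_of_mem hP hG hp.1).of_adj hG hp.2.1.symm ?_
  intro x y hpx hpy hax hay hxa hya hxy
  by_contra! hmiss
  have hcover : ∀ r ∈ K, r ≠ a → G.Adj x r ∨ G.Adj y r := by
    intro r hr hra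
    by_contra! h
    exact h.2 (hmiss r (hK.isClique hp.1 hr hra.symm) (fun h => hp.2.2 r hr hra h.symm)
      (fun e => hK.notMem_of_attachedAt hp (e ▸ hr)) (fun hrx => h.1 hrx.symm)).symm
  obtain ⟨b, c, rfl, hclaw⟩ := hK.exists_isClawOverTriangle hP hG hp hpx hpy
    (mt G.adj_symm hax) (mt G.adj_symm hay) (fun h => hp.2.2 x h hxa hpx)
    (fun h => hp.2.2 y h hya hpy) hxy hcover
  exact hK.not_isClawOverTriangle hP hG hclaw

end IsTopClique

theorem IsPrime.preconnected (hP : IsPrime G) {x y z : V} (hxy : x ≠ y) (hxz : x ≠ z)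
    (hyz : y ≠ z) : G.Preconnected := by
  have hreach : ∀ v, G.Reachable x v := fun v =>
    component_induction (X := Set.univ) (p := G.Reachable x) .rfl
      (fun _ _ _ _ huv hu => hu.trans huv.reachable) v
      (by rw [hP.component_univ hxy hxz hyz]; trivial)
  exact fun u v => (hreach u).symm.trans (hreach v)

theorem exists_adj_dist_eq (hc : G.Preconnected) {k w : V} {d : ℕ} (h : G.dist k w = d + 1) :
    ∃ p, G.Adj p w ∧ G.dist k p = d := by
  obtain ⟨q, hq⟩ := (hc k w).exists_walk_length_eq_dist
  have hnil : ¬q.Nil := fun hnil => by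
    rw [← SimpleGraph.Walk.length_eq_zero_iff] at hnil
    omega
  have hadj := q.adj_penultimate hnil
  refine ⟨q.penultimate, hadj, ?_⟩
  have hlength := SimpleGraph.Walk.length_dropLast_add_one hnil
  have hle := SimpleGraph.dist_le q.dropLast
  have hstep := hadj.symm.diff_dist_adj (u := k)
  omega

namespace IsTopClique

variable {K : Set V}

theorem exists_adj_missing_farther (hK : IsTopClique G K) (hP : IsPrime G) (hG : ForkKiteFree G)
    (hN : ∀ n, ¬Dominates G K n) (hc : G.Preconnected) {k : V} (hk : k ∈ K) (r : V) :
    ∃ s, G.Adj r s ∧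
      ∀ x ∉ K, G.Adj r x → G.dist k x = G.dist k r + 1 → ¬G.Adj s x ∧ s ≠ x := by
  rcases Nat.eq_zero_or_eq_succ_pred (G.dist k r) with hr | hr
  · obtain rfl := (hc k r).dist_eq_zero_iff.1 hr
    obtain ⟨b, hb, hbk, -⟩ := hK.exists_ne_ne k k
    refine ⟨b, hK.isClique hk hb hbk.symm, fun x hx hkx _ => ⟨fun hbx => ?_, fun e => hx (e ▸ hb)⟩⟩
    rcases hK.dominates_or_attachedAt_or_avoids hP hG hx with h | ⟨d, h⟩ | h
    · exact hN x h
    · have hbd : b = d := by_contra fun hbd => h.2.2 b hb hbd hbx.symm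
      exact h.2.2 k hk (fun e => hbk (hbd.trans e.symm)) hkx.symm
    · exact h b hb hbx.symm
  · obtain ⟨s, hsr, hs⟩ := exists_adj_dist_eq hc hr
    refine ⟨s, hsr.symm, fun x _ _ hx => ⟨fun hsx => ?_, ?_⟩⟩
    · have := hsx.diff_dist_adj (u := k)
      omega
    · rintro rfl
      omega

theorem twoCliques_of_forall_not_dominates (hK : IsTopClique G K) (hP : IsPrime G)
    (hG : ForkKiteFree G) (hN : ∀ n, ¬Dominates G K n) (hc : G.Preconnected) {k : V} (hk : k ∈ K)
    (w : V) : TwoCliques G w := by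
  induction hd : G.dist k w using Nat.strong_induction_on generalizing w with
  | _ d ih =>
  by_cases hwK : w ∈ K
  · exact hK.twoCliques_of_mem hP hG hwK
  rcases hK.dominates_or_attachedAt_or_avoids hP hG hwK with h | ⟨a, h⟩ | hw
  · exact absurd h (hN w)
  · exact hK.twoCliques_of_attachedAt hP hG h
  have hd0 : d ≠ 0 := by
    rintro rfl
    exact hwK ((hc k w).dist_eq_zero_iff.1 hd ▸ hk)
  have hd1 : d ≠ 1 := by
    rintro rfl
    exact hw k hk (SimpleGraph.dist_eq_one_iff_adj.1 hd).symm
  obtain ⟨e, rfl⟩ : ∃ e, d = e + 2 := ⟨d - 2, by omega⟩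
  obtain ⟨p, hpw, hp⟩ := exists_adj_dist_eq hc hd
  obtain ⟨r, hrp, hr⟩ := exists_adj_dist_eq hc hp
  have hstep {u v : V} (huv : G.Adj u v) : G.dist k v ≤ G.dist k u + 1 := by
    have := huv.diff_dist_adj (u := k)
    omega
  have hrw : ¬G.Adj r w := fun h => by
    have := hstep h
    omega
  obtain ⟨s, hrs, hs⟩ := hK.exists_adj_missing_farther hP hG hN hc hk r
  have hmiss : ∀ x, G.Adj w x → ¬G.Adj p x → x ≠ p → ¬G.Adj r x := by
    intro x hwx hpx hxp hrx
    have hdx : G.dist k x = G.dist k r + 1 := by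
      have := hstep hrx
      have := hstep hwx.symm
      omega
    have hsp := hs p (fun h => hw p h hpw.symm) hrp (by omega)
    have hsx := hs x (fun h => hw x h hwx) hrx hdx
    exact (ih _ (by omega) r hr).not_isClaw
      ⟨⟨hrs, hrp, hrx⟩, ⟨hsp.2, hsx.2, hxp.symm⟩, hsp.1, hsx.1, hpx⟩
  refine (ih _ (by omega) p hp).of_adj hG hpw fun x y hwx hwy hpx hpy hxp hyp _ => ?_
  exact ⟨r, hrp.symm, hrw, by rintro rfl; omega, hmiss x hwx hpx hxp, hmiss y hwy hpy hyp⟩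

theorem twoCliques_of_avoids (hK : IsTopClique G K) (hP : IsPrime G) (hG : ForkKiteFree G)
    {n w : V} (hn : Dominates G K n) (hw : Avoids G K w) : TwoCliques G w := by
  have hattached : ∀ x, G.Adj w x → ¬G.Adj n x → x ≠ n → ∃ a, AttachedAt G K x a := by
    intro x hwx hnx hxn
    rcases hK.dominates_or_attachedAt_or_avoids hP hG (fun h => hw x h hwx) with h | h | h
    · exact absurd (hK.eq_of_dominates hP hG h hn) hxn
    · exact h
    · exact absurd (hK.adj_of_dominates hn h) hnx
  refine (hK.twoCliques_of_dominates hP hG hn).of_adj hG (hK.adj_of_dominates hn hw) ?_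
  intro x y hwx hwy hnx hny hxn hyn _
  obtain ⟨a, ha⟩ := hattached x hwx hnx hxn
  obtain ⟨b, hb⟩ := hattached y hwy hny hyn
  obtain ⟨r, hr, hra, hrb⟩ := hK.exists_ne_ne a b
  exact ⟨r, hn.2 r hr, fun h => hw r hr h.symm, fun e => hK.notMem_of_avoids hw (e ▸ hr),
    fun h => ha.2.2 r hr hra h.symm, fun h => hb.2.2 r hr hrb h.symm⟩

theorem twoCliques (hK : IsTopClique G K) (hP : IsPrime G) (hG : ForkKiteFree G) (w : V) :
    TwoCliques G w := by
  by_cases hN : ∃ n, Dominates G K n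
  · obtain ⟨n, hn⟩ := hN
    by_cases hwK : w ∈ K
    · exact hK.twoCliques_of_mem hP hG hwK
    rcases hK.dominates_or_attachedAt_or_avoids hP hG hwK with h | ⟨a, h⟩ | h
    · exact hK.twoCliques_of_dominates hP hG h
    · exact hK.twoCliques_of_attachedAt hP hG h
    · exact hK.twoCliques_of_avoids hP hG hn h
  · obtain ⟨b, hb, c, -, hbw, hcw, hbc⟩ := hK.exists_edge_avoiding w
    exact hK.twoCliques_of_forall_not_dominates hP hG (not_exists.1 hN)
      (hP.preconnected hbc.ne hbw hcw) hb w

end IsTopClique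

/-- No induced complement of a claw. -/
def CoclawFree (G : SimpleGraph V) : Prop :=
  ∀ a b c w, ¬IsCoclaw G a b c w

/-- No induced claw. -/
def ClawFree (G : SimpleGraph V) : Prop :=
  ∀ v x y z, ¬IsClaw G v x y z

theorem IsPrime.coclawFree_or_twoCliques [Finite V] (hP : IsPrime G) (hG : ForkKiteFree G) :
    CoclawFree G ∨ ∀ v, TwoCliques G v := by
  by_contra! h
  obtain ⟨hcoclaw, v, hv⟩ := h
  refine hcoclaw fun a b c w hT => ?_
  obtain ⟨K, hK⟩ := hT.exists_isTopClique
  exact hv (hK.twoCliques hP hG v)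

theorem CoclawFree.clawFree_compl (h : CoclawFree G) : ClawFree Gᶜ := by
  intro v x y z hv
  refine h x y z v ?_
  grind [IsClaw, IsCoclaw, SimpleGraph.compl_adj, G.adj_comm]

theorem ClawFree.exists_isDiamond (h : ClawFree G) {v : V} (hv : ¬TwoCliques G v) :
    ∃ a b c d, IsDiamond G a b c d := by
  by_contra! hD
  have htrans {x y z : V} (hx : G.Adj v x) (hy : G.Adj v y) (hz : G.Adj v z) (hxy : G.Adj x y)
      (hyz : G.Adj y z) (hxz : x ≠ z) : G.Adj x z :=
    by_contra fun hn => hD v y x z ⟨hy, hx, hz, hxy.symm, hyz, hn, hxz⟩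
  obtain ⟨b, hb⟩ : ∃ b, G.Adj v b := by
    by_contra! hb
    exact hv ⟨∅, fun x _ hx => absurd hx (hb x)⟩
  refine hv (.of_partition {x | x = b ∨ G.Adj b x} ?_ ?_ ?_)
  · rintro x (rfl | hbx) y (rfl | hby) hx hy hxy
    · exact absurd rfl hxy
    · exact hby
    · exact hbx.symm
    · exact htrans hx hb hy hbx.symm hby hxy
  · intro x hxb y hyb hx hy hxy
    by_contra hn
    obtain ⟨hbx, hnbx⟩ := not_or.1 hxb
    obtain ⟨hby, hnby⟩ := not_or.1 hyb
    exact h v b x y ⟨⟨hb, hx, hy⟩, ⟨Ne.symm hbx, Ne.symm hby, hxy⟩, hnbx, hnby, hn⟩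
  · rintro x (rfl | hbx) y hyb hx hy hxy
    · exact hyb (.inr hxy)
    · exact hyb (.inr (htrans hb hx hy hbx hxy fun e => hyb (.inl e.symm)))

section Diamonds

variable {a b c d v w x y z : V}

theorem IsDiamond.adj_or_adj (hC : ClawFree G) (hT : CoclawFree G) (h : IsDiamond G a b c d)
    (hc : v ≠ c) (hd : v ≠ d) : G.Adj v c ∨ G.Adj v d := by
  grind [IsDiamond, IsClaw, IsCoclaw, G.adj_comm, hC a c d v, hC b c d v, hT a b c v]

theorem IsDiamond.not_adj_of_compl (hC : ClawFree G) (hT : CoclawFree G)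
    (h : IsDiamond Gᶜ y z w x) (hvw : G.Adj v w) : ¬G.Adj v x := by
  grind [IsDiamond, IsClaw, IsCoclaw, SimpleGraph.compl_adj, G.adj_comm, hC v y z w, hT v w x y,
    hT v w x z]

theorem IsDiamond.ne_of_compl (hC : ClawFree G) (hT : CoclawFree G) (h : IsDiamond G a b c d)
    (h' : IsDiamond Gᶜ y z w x) : c ≠ w := by
  rintro rfl
  have hends {v : V} := h.adj_or_adj hC hT (v := v)
  have hax := h'.not_adj_of_compl hC hT h.2.1
  have hbx := h'.not_adj_of_compl hC hT h.2.2.2.1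
  have hy := hends (v := y)
  have hz := hends (v := z)
  grind [IsDiamond, IsClaw, IsCoclaw, SimpleGraph.compl_adj, G.adj_comm, hT a b d x, hC d x y z]

theorem IsDiamond.not_adj_of_compl_of_adj (hC : ClawFree G) (hT : CoclawFree G)
    (h : IsDiamond G a b c d) (h' : IsDiamond Gᶜ y z w x) (hcx : c ≠ x) (hwc : G.Adj w c)
    (hxd : G.Adj x d) (hyc : G.Adj y c) : ¬G.Adj z d := by
  intro hzd
  have hwd : ¬G.Adj w d := fun h => h'.not_adj_of_compl hC hT h.symm hxd.symm
  have hxc : ¬G.Adj x c := fun h => h'.not_adj_of_compl hC hT hwc.symm h.symm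
  have hcz : ¬G.Adj c z := by
    grind [IsDiamond, IsClaw, SimpleGraph.compl_adj, G.adj_comm, G.ne_of_adj, hC c w y z]
  have hdy : ¬G.Adj d y := by
    grind [IsDiamond, IsClaw, SimpleGraph.compl_adj, G.adj_comm, G.ne_of_adj, hC d x y z]
  grind [IsDiamond, IsClaw, IsCoclaw, SimpleGraph.compl_adj, G.adj_comm, G.ne_of_adj,
    hC c a w y, hT a c w z, hT a c y x, hT a c y z, hT a d z y, hC a c x z]

theorem IsDiamond.swap_ends (h : IsDiamond G a b c d) : IsDiamond G a b d c := by
  grind [IsDiamond, G.adj_comm]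

theorem IsDiamond.swap_hubs (h : IsDiamond G a b c d) : IsDiamond G b a c d := by
  grind [IsDiamond, G.adj_comm]

theorem IsDiamond.not_isDiamond_compl_of_adj (hC : ClawFree G) (hT : CoclawFree G)
    (h : IsDiamond G a b c d) (hwc : G.Adj w c) : ¬IsDiamond Gᶜ y z w x := by
  intro h'
  have hcx := h.ne_of_compl hC hT h'.swap_ends
  have hends {v : V} := h.adj_or_adj hC hT (v := v)
  have hsplit {v : V} := h'.not_adj_of_compl hC hT (v := v)
  have hdx := h.swap_ends.ne_of_compl hC hT h'.swap_ends
  have hxd : G.Adj x d := (hends hcx.symm hdx.symm).resolve_left fun h => hsplit hwc.symm h.symm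
  have hpath := h.not_adj_of_compl_of_adj hC hT h' hcx (hwc := hwc) (hxd := hxd)
  have hpath' := h.not_adj_of_compl_of_adj hC hT h'.swap_hubs hcx (hwc := hwc) (hxd := hxd)
  have hy := hends (v := y)
  have hz := hends (v := z)
  grind +splitImp [IsDiamond, IsClaw, SimpleGraph.compl_adj, G.adj_comm, G.ne_of_adj, hC c w y z,
    hC d x y z]

theorem IsDiamond.not_isDiamond_compl (hC : ClawFree G) (hT : CoclawFree G)
    (h : IsDiamond G a b c d) : ¬IsDiamond Gᶜ y z w x := by
  intro h'
  rcases h.adj_or_adj hC hT (h.ne_of_compl hC hT h').symm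
    (h.swap_ends.ne_of_compl hC hT h').symm with hwc | hwd
  · exact h.not_isDiamond_compl_of_adj hC hT hwc h'
  · exact h.swap_ends.not_isDiamond_compl_of_adj hC hT hwd h'

end Diamonds

theorem IsPrime.twoCliques_or_compl [Finite V] (hP : IsPrime G) (hG : ForkKiteFree G) :
    (∀ v, TwoCliques G v) ∨ ∀ v, TwoCliques Gᶜ v := by
  by_contra! h
  obtain ⟨⟨u, hu⟩, v, hv⟩ := h
  have hT : CoclawFree G := (hP.coclawFree_or_twoCliques hG).resolve_right fun h => hu (h u)
  have hT' : CoclawFree Gᶜ :=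
    (hP.compl.coclawFree_or_twoCliques hG.compl).resolve_right fun h => hv (h v)
  have hC : ClawFree G := by simpa only [compl_compl] using hT'.clawFree_compl
  obtain ⟨a, b, c, d, h⟩ := hC.exists_isDiamond hu
  obtain ⟨y, z, w, x, h'⟩ := hT.clawFree_compl.exists_isDiamond hv
  exact h.not_isDiamond_compl hC hT h'

theorem nonempty_iso_lineGraph {W : Type*} (f : V → Sym2 W) (hf : Function.Injective f)
    (hdiag : ∀ v, ¬(f v).IsDiag)
    (hadj : ∀ u v, u ≠ v → (G.Adj u v ↔ ∃ x, x ∈ f u ∧ x ∈ f v)) :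
    Nonempty (G ≃g (SimpleGraph.fromEdgeSet (Set.range f)).lineGraph) := by
  have hedge : (SimpleGraph.fromEdgeSet (Set.range f)).edgeSet = Set.range f := by
    rw [SimpleGraph.edgeSet_fromEdgeSet, sdiff_eq_left, Set.disjoint_left]
    rintro _ ⟨v, rfl⟩
    exact hdiag v
  let e : V ≃ (SimpleGraph.fromEdgeSet (Set.range f)).edgeSet :=
    (Equiv.ofInjective f hf).trans (Equiv.setCongr hedge.symm)
  refine ⟨e, fun {u v} => ?_⟩
  rw [SimpleGraph.lineGraph_adj_iff_exists, e.injective.ne_iff]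
  exact ⟨fun ⟨hne, h⟩ => (hadj u v hne).2 h, fun h => ⟨h.ne, (hadj u v h.ne).1 h⟩⟩

section Ends

variable {S : V → Set V} {u v w : V}

/-- Each vertex has two ends, `true` for its neighbours in `S v` and `false` for the others; the
ends of two adjacent vertices at which they see each other are identified. These are the vertices of
the graph whose line graph is `G`. -/
def endSetoid (hS : ∀ v, IsCliqueSplit G v (S v)) : Setoid (V × Bool) where
  r a b := a = b ∨ G.Adj a.1 b.1 ∧ (b.1 ∈ S a.1 ↔ a.2 = true) ∧ (a.1 ∈ S b.1 ↔ b.2 = true)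
  iseqv := by
    refine ⟨fun a => .inl rfl, ?_, ?_⟩
    · rintro a b (rfl | ⟨h, ha, hb⟩)
      · exact .inl rfl
      · exact .inr ⟨h.symm, hb, ha⟩
    · rintro ⟨u, i⟩ ⟨v, j⟩ ⟨w, k⟩ (h | ⟨huv, hu, hv⟩) (h' | ⟨hvw, hv', hw⟩)
      · exact .inl (h.trans h')
      · exact h ▸ .inr ⟨hvw, hv', hw⟩
      · exact h' ▸ .inr ⟨huv, hu, hv⟩
      · dsimp only at huv hu hv hvw hv' hw
        rcases eq_or_ne u w with rfl | huw
        · exact .inl (Prod.ext rfl (Bool.eq_iff_iff.2 (hu.symm.trans hw)))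
        · have huw' : G.Adj u w := (hS v u w huv.symm hvw huw).2 (hv.trans hv'.symm)
          exact .inr ⟨huw', ((hS u v w huv huw' hvw.ne).1 hvw).symm.trans hu,
            ((hS w u v huw'.symm hvw.symm huv.ne).1 huv).trans hw⟩

variable (hS : ∀ v, IsCliqueSplit G v (S v))

/-- The end of `v` on side `i`. -/
def vertexEnd (v : V) (i : Bool) : Quotient (endSetoid hS) :=
  Quotient.mk _ (v, i)

/-- The pair of ends of `v`, which is the edge corresponding to `v`. -/
def ends (v : V) : Sym2 (Quotient (endSetoid hS)) :=
  s(vertexEnd hS v true, vertexEnd hS v false)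

variable {hS}

theorem mem_ends {x : Quotient (endSetoid hS)} : x ∈ ends hS v ↔ ∃ i, x = vertexEnd hS v i := by
  simp [ends, or_comm]

theorem vertexEnd_true_ne_false : vertexEnd hS v true ≠ vertexEnd hS v false := by
  intro h
  rcases Quotient.exact h with h | h
  · simp at h
  · exact G.irrefl h.1

theorem adj_iff_exists_mem_ends (huv : u ≠ v) :
    G.Adj u v ↔ ∃ x, x ∈ ends hS u ∧ x ∈ ends hS v := by
  classical
  refine ⟨fun h => ⟨vertexEnd hS u (decide (v ∈ S u)), mem_ends.2 ⟨_, rfl⟩,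
    mem_ends.2 ⟨decide (u ∈ S v), Quotient.sound (.inr ⟨h, by simp, by simp⟩)⟩⟩, ?_⟩
  rintro ⟨x, hu, hv⟩
  obtain ⟨i, rfl⟩ := mem_ends.1 hu
  obtain ⟨j, hj⟩ := mem_ends.1 hv
  rcases Quotient.exact hj with h | h
  · exact absurd (congrArg Prod.fst h) huv
  · exact h.1

open Classical in
theorem eq_vertexEnd_of_mem_ends (huv : u ≠ v) {x : Quotient (endSetoid hS)} (hu : x ∈ ends hS u)
    (hv : x ∈ ends hS v) : x = vertexEnd hS u (decide (v ∈ S u)) := by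
  obtain ⟨i, rfl⟩ := mem_ends.1 hu
  obtain ⟨j, hj⟩ := mem_ends.1 hv
  rcases Quotient.exact hj with h | ⟨-, h, -⟩
  · exact absurd (congrArg Prod.fst h) huv
  · rw [Bool.decide_congr h, Bool.decide_eq_true]

theorem ends_injective : Function.Injective (ends hS) := by
  intro u v h
  by_contra huv
  have hend (i) : vertexEnd hS u i ∈ ends hS u := mem_ends.2 ⟨i, rfl⟩
  exact vertexEnd_true_ne_false ((eq_vertexEnd_of_mem_ends huv (hend true) (h ▸ hend true)).trans
    (eq_vertexEnd_of_mem_ends huv (hend false) (h ▸ hend false)).symm)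

theorem eq_of_mem_ends (huv : u ≠ v) (huw : u ≠ w) (hvw : G.Adj v w)
    {x y : Quotient (endSetoid hS)} (hxu : x ∈ ends hS u) (hxv : x ∈ ends hS v)
    (hyu : y ∈ ends hS u) (hyw : y ∈ ends hS w) : x = y := by
  have hsame : v ∈ S u ↔ w ∈ S u := (hS u v w ((adj_iff_exists_mem_ends huv).2 ⟨x, hxu, hxv⟩)
    ((adj_iff_exists_mem_ends huw).2 ⟨y, hyu, hyw⟩) hvw.ne).1 hvw
  rw [eq_vertexEnd_of_mem_ends huv hxu hxv, eq_vertexEnd_of_mem_ends huw hyu hyw,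
    decide_eq_decide.2 hsame]

theorem cliqueFree_fromEdgeSet_range_ends :
    (SimpleGraph.fromEdgeSet (Set.range (ends hS))).CliqueFree 3 := by
  classical
  intro s hs
  obtain ⟨x, y, z, hxy, hxz, hyz, -⟩ := SimpleGraph.is3Clique_iff.1 hs
  rw [SimpleGraph.fromEdgeSet_adj] at hxy hxz hyz
  obtain ⟨⟨u, hu⟩, hxy⟩ := hxy
  obtain ⟨⟨v, hv⟩, hxz⟩ := hxz
  obtain ⟨⟨w, hw⟩, hyz⟩ := hyz
  have huv : u ≠ v := by rintro rfl; grind [Sym2.eq_iff]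
  have huw : u ≠ w := by rintro rfl; grind [Sym2.eq_iff]
  have hvw : v ≠ w := by rintro rfl; grind [Sym2.eq_iff]
  have hvw' : G.Adj v w :=
    (adj_iff_exists_mem_ends (hS := hS) hvw).2 ⟨z, by simp [hv], by simp [hw]⟩
  exact hxy (eq_of_mem_ends huv huw hvw' (by simp [hu]) (by simp [hv]) (by simp [hu])
    (by simp [hw]))

end Ends

theorem isLineGraphOfTriangleFree [Finite V] (h : ∀ v, TwoCliques G v) :
    IsLineGraphOfTriangleFree G := by
  choose S hS using h
  let H := SimpleGraph.fromEdgeSet (Set.range (ends hS))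
  obtain ⟨φ⟩ : Nonempty (G ≃g H.lineGraph) := nonempty_iso_lineGraph (ends hS) ends_injective
    (fun v => by simpa [ends] using vertexEnd_true_ne_false)
    (fun u v => adj_iff_exists_mem_ends)
  have := Fintype.ofFinite (Quotient (endSetoid hS))
  let ψ := H.overFinIso rfl
  exact ⟨_, _, cliqueFree_fromEdgeSet_range_ends.comap ⟨ψ.symm.toCopy⟩, ⟨φ.trans ψ.lineGraph⟩⟩

theorem isDisconnected_of_anticompleteTo_compl {A : Set V} {x y : V} (hx : x ∈ A) (hy : y ∉ A)
    (h : AnticompleteTo G A Aᶜ) : IsDisconnected G := by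
  intro hconn
  obtain ⟨p⟩ := hconn x y
  induction p with
  | nil => exact hy hx
  | cons huv _ ih => exact ih (by_contra fun hv => h _ hx _ hv huv) hy

theorem IsModule.union {X Y : Set V} (hX : IsModule G X) (hY : IsModule G Y) {z : V}
    (hzX : z ∈ X) (hzY : z ∈ Y) : IsModule G (X ∪ Y) := by
  have key : ∀ v ∉ X ∪ Y, ∀ x ∈ X ∪ Y, (G.Adj v x ↔ G.Adj v z) := by
    rintro v hv x (hx | hx)
    · exact ⟨hX hx hzX (mt Or.inl hv), hX hzX hx (mt Or.inl hv)⟩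
    · exact ⟨hY hx hzY (mt Or.inr hv), hY hzY hx (mt Or.inr hv)⟩
  exact fun x hx y hy v hv h => (key v hv y hy).2 ((key v hv x hx).1 h)

theorem IsModule.isDisconnected_of_union {X Y : Set V} (hX : IsModule G X) (hY : IsModule G Y)
    (hXu : X ≠ Set.univ) (hYu : Y ≠ Set.univ) (hXY : X ∪ Y = Set.univ) {z : V}
    (hzX : z ∈ X) (hzY : z ∈ Y) : IsDisconnected G ∨ IsDisconnected Gᶜ := by
  obtain ⟨y, hy⟩ := (Set.ne_univ_iff_exists_notMem X).1 hXu
  obtain ⟨x, hx⟩ := (Set.ne_univ_iff_exists_notMem Y).1 hYu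
  have hcover : ∀ u, u ∈ X ∨ u ∈ Y := fun u => (Set.eq_univ_iff_forall.1 hXY) u
  have hyY : y ∈ Y := (hcover y).resolve_left hy
  have hconst : ∀ v ∈ Y, ∀ u ∉ Y, (G.Adj v u ↔ G.Adj y z) := by
    intro v hv u hu
    have huX : u ∈ X := (hcover u).resolve_right hu
    calc G.Adj v u ↔ G.Adj u v := G.adj_comm v u
      _ ↔ G.Adj u y := ⟨hY hv hyY hu, hY hyY hv hu⟩
      _ ↔ G.Adj y u := G.adj_comm u y
      _ ↔ G.Adj y z := ⟨hX huX hzX hy, hX hzX huX hy⟩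
  by_cases h : G.Adj y z
  · exact .inr (isDisconnected_of_anticompleteTo_compl hzY hx fun v hv u hu e =>
      e.2 ((hconst v hv u hu).2 h))
  · exact .inl (isDisconnected_of_anticompleteTo_compl hzY hx fun v hv u hu e =>
      h ((hconst v hv u hu).1 e))

theorem IsModule.union_ne_univ {X Y : Set V} (h₁ : ¬IsDisconnected G) (h₂ : ¬IsDisconnected Gᶜ)
    (hX : IsModule G X) (hY : IsModule G Y) (hXu : X ≠ Set.univ) (hYu : Y ≠ Set.univ) {z : V}
    (hzX : z ∈ X) (hzY : z ∈ Y) : X ∪ Y ≠ Set.univ := fun h =>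
  (hX.isDisconnected_of_union hY hXu hYu h hzX hzY).elim h₁ h₂

/-- `H` is the quotient of `G` by a partition into modules, the fibres of `π`. -/
structure IsModularQuotient {W : Type*} (G : SimpleGraph V) (H : SimpleGraph W) (π : V → W) :
    Prop where
  surj : Function.Surjective π
  adj : ∀ u v, π u ≠ π v → (G.Adj u v ↔ H.Adj (π u) (π v))

namespace IsModularQuotient

variable {W : Type*} {H : SimpleGraph W} {π : V → W}

theorem compl (h : IsModularQuotient G H π) : IsModularQuotient Gᶜ Hᶜ π := by
  refine ⟨h.surj, fun u v huv => ?_⟩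
  have : u ≠ v := fun e => huv (congrArg π e)
  simp [huv, this, h.adj u v huv]

theorem forkKiteFree (h : IsModularQuotient G H π) (hG : ForkKiteFree G) : ForkKiteFree H := by
  obtain ⟨f, hf⟩ := h.surj.hasRightInverse
  have hadj : ∀ x y, H.Adj x y ↔ G.Adj (f x) (f y) := by
    intro x y
    rcases eq_or_ne x y with rfl | hxy
    · simp
    · rw [h.adj _ _ (by rwa [hf, hf]), hf, hf]
  constructor
  · intro a b c d e
    simpa only [hadj, hf.injective.ne_iff] using hG.fork (f a) (f b) (f c) (f d) (f e)
  · intro a b c d w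
    simpa only [hadj] using hG.kite (f a) (f b) (f c) (f d) (f w)

theorem isModule_preimage (h : IsModularQuotient G H π) {X : Set W} (hX : IsModule H X) :
    IsModule G (π ⁻¹' X) := by
  intro x hx y hy v hv hvx
  have hne : ∀ {z}, z ∈ π ⁻¹' X → π v ≠ π z := fun hz e => hv (by rwa [Set.mem_preimage, e])
  exact (h.adj v y (hne hy)).2 (hX hx hy hv ((h.adj v x (hne hx)).1 hvx))

theorem isDisconnected_of_isolated [Nontrivial W] (h : IsModularQuotient G H π) {b : W}
    (hb : ∀ x, ¬H.Adj b x) : IsDisconnected G := by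
  obtain ⟨c, hc⟩ := exists_ne b
  obtain ⟨u, hu⟩ := h.surj b
  obtain ⟨v, rfl⟩ := h.surj c
  refine isDisconnected_of_anticompleteTo_compl (A := {x | π x = b}) hu hc ?_
  rintro x rfl y hy hxy
  exact hb _ ((h.adj x y (Ne.symm hy)).1 hxy)

end IsModularQuotient

/-- The graph induced on a set of representatives of the classes of `r`; when these classes are
modules the choice of representatives does not matter. -/
noncomputable def quotientGraph (G : SimpleGraph V) (r : Setoid V) : SimpleGraph (Quotient r) :=
  G.comap Quotient.out

theorem isModularQuotient_quotientGraph {r : Setoid V} (h : ∀ x, IsModule G {y | r y x}) :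
    IsModularQuotient G (quotientGraph G r) (Quotient.mk r) := by
  refine ⟨Quotient.mk_surjective, fun u v huv => ?_⟩
  have hconst : ∀ {x y z}, r x y → ¬r z y → (G.Adj z x ↔ G.Adj z y) := fun {x y z} hxy hzy =>
    ⟨h y hxy (r.refl y) hzy, h y (r.refl y) hxy hzy⟩
  have hu : r (Quotient.mk r u).out u := Quotient.mk_out u
  have hv : r (Quotient.mk r v).out v := Quotient.mk_out v
  have hnot : ¬r u v := fun e => huv (Quotient.sound e)
  calc G.Adj u v ↔ G.Adj u (Quotient.mk r v).out := (hconst hv hnot).symm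
    _ ↔ G.Adj (Quotient.mk r v).out u := G.adj_comm _ _
    _ ↔ G.Adj (Quotient.mk r v).out (Quotient.mk r u).out :=
      (hconst hu fun e => hnot (r.trans (r.symm e) hv)).symm
    _ ↔ G.Adj (Quotient.mk r u).out (Quotient.mk r v).out := G.adj_comm _ _

/-- Two vertices are equivalent if they are equal or share a proper module. When `G` and its
complement are connected, the classes are the maximal proper modules. -/
def moduleSetoid (h₁ : ¬IsDisconnected G) (h₂ : ¬IsDisconnected Gᶜ) : Setoid V where
  r u v := u = v ∨ ∃ X, IsModule G X ∧ X ≠ Set.univ ∧ u ∈ X ∧ v ∈ X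
  iseqv := by
    refine ⟨fun u => .inl rfl, ?_, ?_⟩
    · rintro u v (rfl | ⟨X, hX, hXu, hu, hv⟩)
      · exact .inl rfl
      · exact .inr ⟨X, hX, hXu, hv, hu⟩
    · rintro u v w (rfl | ⟨X, hX, hXu, hu, hvX⟩) (rfl | ⟨Y, hY, hYu, hvY, hw⟩)
      · exact .inl rfl
      · exact .inr ⟨Y, hY, hYu, hvY, hw⟩
      · exact .inr ⟨X, hX, hXu, hu, hvX⟩
      · exact .inr ⟨X ∪ Y, hX.union hY hvX hvY, hX.union_ne_univ h₁ h₂ hY hXu hYu hvX hvY,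
          .inl hu, .inr hw⟩

section ModuleSetoid

variable (h₁ : ¬IsDisconnected G) (h₂ : ¬IsDisconnected Gᶜ)

theorem isModule_moduleSetoid_class (x : V) : IsModule G {y | moduleSetoid h₁ h₂ y x} := by
  intro u hu v hv w hw hwu
  have huv : moduleSetoid h₁ h₂ u v := (moduleSetoid h₁ h₂).trans hu ((moduleSetoid h₁ h₂).symm hv)
  rcases huv with rfl | ⟨X, hX, hXu, huX, hvX⟩
  · exact hwu
  · refine hX huX hvX (fun hwX => hw ?_) hwu
    exact (moduleSetoid h₁ h₂).trans (.inr ⟨X, hX, hXu, hwX, huX⟩) hu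

theorem isModularQuotient_moduleSetoid :
    IsModularQuotient G (quotientGraph G (moduleSetoid h₁ h₂)) (Quotient.mk _) :=
  isModularQuotient_quotientGraph (isModule_moduleSetoid_class h₁ h₂)

theorem isPrime_quotientGraph_moduleSetoid : IsPrime (quotientGraph G (moduleSetoid h₁ h₂)) := by
  have hq := isModularQuotient_moduleSetoid h₁ h₂
  intro X hX
  refine or_iff_not_imp_right.2 fun hXu x hx y hy => ?_
  have hpre : Quotient.mk (moduleSetoid h₁ h₂) ⁻¹' X ≠ Set.univ := by
    rwa [Ne, Set.preimage_eq_univ_iff, hq.surj.range_eq, Set.univ_subset_iff]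
  obtain ⟨x, rfl⟩ := hq.surj x
  obtain ⟨y, rfl⟩ := hq.surj y
  exact Quotient.sound (.inr ⟨_, hq.isModule_preimage hX, hpre, hx, hy⟩)

theorem nontrivial_quotient_moduleSetoid [Finite V] [Nontrivial V] :
    Nontrivial (Quotient (moduleSetoid h₁ h₂)) := by
  obtain ⟨v, w, hvw⟩ := exists_pair_ne V
  have hsingleton : IsModule G {v} ∧ {v} ≠ Set.univ := by
    refine ⟨?_, (Set.ne_univ_iff_exists_notMem _).2 ⟨w, hvw.symm⟩⟩
    rintro x rfl y rfl _ - h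
    exact h
  obtain ⟨X, hvX, ⟨hX, hXu⟩, hmax⟩ :=
    (Set.toFinite {X : Set V | IsModule G X ∧ X ≠ Set.univ}).exists_le_maximal hsingleton
  replace hvX : v ∈ X := hvX rfl
  obtain ⟨u, hu⟩ := (Set.ne_univ_iff_exists_notMem X).1 hXu
  refine ⟨⟨Quotient.mk _ u, Quotient.mk _ v, fun huv => hu ?_⟩⟩
  rcases Quotient.exact huv with rfl | ⟨Y, hY, hYu, huY, hvY⟩
  · exact hvX
  · exact hmax ⟨hX.union hY hvX hvY, hX.union_ne_univ h₁ h₂ hY hXu hYu hvX hvY⟩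
      Set.subset_union_left (.inr huY)

end ModuleSetoid

theorem exists_isModularQuotient.{u} {V : Type u} {G : SimpleGraph V} [Finite V] [Nontrivial V]
    (h₁ : ¬IsDisconnected G) (h₂ : ¬IsDisconnected Gᶜ) :
    ∃ (W : Type u) (_ : Finite W) (_ : Nontrivial W) (H : SimpleGraph W) (π : V → W),
      IsModularQuotient G H π ∧ IsPrime H :=
  ⟨_, inferInstance, nontrivial_quotient_moduleSetoid h₁ h₂, _, _,
    isModularQuotient_moduleSetoid h₁ h₂, isPrime_quotientGraph_moduleSetoid h₁ h₂⟩

/-- Some two vertices in the fibre of `π` over `w` are adjacent. -/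
def FibreHasEdge {W : Type*} (G : SimpleGraph V) (π : V → W) (w : W) : Prop :=
  ∃ u v, π u = w ∧ π v = w ∧ G.Adj u v

/-- The vertex set is the union of the clique `B` and a stable set, the complement of `B`. -/
def IsSplitBy (G : SimpleGraph V) (B : Set V) : Prop :=
  G.IsClique B ∧ G.IsIndepSet Bᶜ

theorem isSplitBy_of_isSimplicial {r : V} (h : IsSimplicial G r) (h' : IsSimplicial Gᶜ r) :
    IsSplitBy G (insert r (G.neighborSet r)) := by
  refine ⟨h.insert fun x hx _ => hx, fun x hx y hy hxy => ?_⟩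
  simp only [Set.mem_compl_iff, Set.mem_insert_iff, SimpleGraph.mem_neighborSet, not_or] at hx hy
  exact (h' ⟨Ne.symm hx.1, hx.2⟩ ⟨Ne.symm hy.1, hy.2⟩ hxy).2

theorem TwoCliques.isSplitBy {v z z' : V} (h : TwoCliques G z') (hv : IsSimplicial G v)
    (hz : IsSimplicial Gᶜ z) (hz' : IsSimplicial Gᶜ z') (hzv : Gᶜ.Adj z v) (hvz' : G.Adj v z') :
    IsSplitBy G (insert z' (G.neighborSet z' \ {v})) := by
  have hzz' : G.Adj z' z := by
    by_contra hn
    have hne : z ≠ z' := by rintro rfl; exact hzv.2 hvz'.symm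
    exact (hz hzv ⟨hne, mt G.adj_symm hn⟩ hvz'.ne).2 hvz'
  have hadj_z : ∀ x, G.Adj z' x → x ≠ v → x ≠ z → G.Adj z x := by
    intro x hx hxv hxz
    by_contra hn
    have hvx : ¬G.Adj v x := (hz hzv ⟨hxz.symm, hn⟩ hxv.symm).2
    exact h.not_isClaw ⟨⟨hzz', hvz'.symm, hx⟩, ⟨hzv.ne, hxz.symm, hxv.symm⟩, hzv.2, hn, hvx⟩
  constructor
  · refine SimpleGraph.IsClique.insert ?_ fun x hx _ => hx.1
    rintro x ⟨hx, hxv⟩ y ⟨hy, hyv⟩ hxy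
    rcases eq_or_ne x z with rfl | hxz
    · exact hadj_z y hy hyv hxy.symm
    rcases eq_or_ne y z with rfl | hyz
    · exact (hadj_z x hx hxv hxz).symm
    · exact h.adj_trans hx hzz' hy hxy (hadj_z x hx hxv hxz).symm (hadj_z y hy hyv hyz)
  · have hstable : ∀ x, x = v ∨ Gᶜ.Adj z' x → ∀ y, Gᶜ.Adj z' y → ¬G.Adj x y := by
      rintro x (rfl | hx) y hy hxy
      · exact hy.2 (hv hvz' hxy hy.1)
      · exact (hz' hx hy hxy.ne).2 hxy
    intro x hx y hy hxy h'
    grind [SimpleGraph.mem_neighborSet, SimpleGraph.compl_adj, G.adj_comm]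

theorem IsSplitBy.exists_forall_exists_not_adj [Finite V] {B : Set V} (hB : IsSplitBy G B) :
    ∃ B, IsSplitBy G B ∧ ∀ d ∉ B, ∃ b ∈ B, ¬G.Adj d b := by
  obtain ⟨B, -, hB, hmax⟩ := (Set.toFinite {B : Set V | IsSplitBy G B}).exists_le_maximal hB
  refine ⟨B, hB, fun d hd => ?_⟩
  by_contra! h
  refine hd (hmax (y := insert d B) ⟨hB.1.insert fun b hb _ => h b hb, ?_⟩
    (Set.subset_insert d B) (Set.mem_insert d B))
  exact Set.Pairwise.mono (Set.compl_subset_compl.2 (Set.subset_insert d B)) hB.2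

/-- A candling of `G` all of whose cliques `{y i}` and stable sets `{z i}` are singletons. -/
structure IsThinCandling {ι : Type*} (G : SimpleGraph V) (y z : ι → V) : Prop where
  not_adj : ∀ i j, ¬G.Adj (y i) (y j)
  adj : ∀ i j, i ≠ j → G.Adj (z i) (z j)
  adj_iff : ∀ i j, G.Adj (y i) (z j) ↔ i = j
  adj_rest : ∀ i, ∀ v ∉ Set.range y ∪ Set.range z, G.Adj (z i) v
  not_adj_rest : ∀ i, ∀ v ∉ Set.range y ∪ Set.range z, ¬G.Adj (y i) v

section Split

variable {B : Set V} (hB : IsSplitBy G B) (hmiss : ∀ d ∉ B, ∃ b ∈ B, ¬G.Adj d b)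

include hB

theorem IsSplitBy.mem_of_adj {v d : V} (hd : d ∉ B) (h : G.Adj v d) : v ∈ B :=
  by_contra fun hv => hB.2 hv hd h.ne h

include hmiss

theorem IsSplitBy.eq_of_adj_of_adj (hL : ∀ v, TwoCliques G v) {b b' d : V} (hd : d ∉ B)
    (hbd : G.Adj b d) (hbd' : G.Adj b' d) : b = b' := by
  by_contra hbb'
  have hb : b ∈ B := hB.mem_of_adj hd hbd
  have hb' : b' ∈ B := hB.mem_of_adj hd hbd'
  obtain ⟨c, hc, hdc⟩ := hmiss d hd
  have hbc : b ≠ c := by rintro rfl; exact hdc hbd.symm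
  have hbc' : b' ≠ c := by rintro rfl; exact hdc hbd'.symm
  have hcd : d ≠ c := by rintro rfl; exact hd hc
  exact hdc ((hL b).adj_trans hbd (hB.1 hb hb' hbb') (hB.1 hb hc hbc) hcd hbd'.symm
    (hB.1 hb' hc hbc'))

theorem IsSplitBy.eq_of_adj (hP : IsPrime G) (hL : ∀ v, TwoCliques G v) {b d d' : V}
    (hd : d ∉ B) (hd' : d' ∉ B) (hbd : G.Adj b d) (hbd' : G.Adj b d') : d = d' := by
  by_contra hdd'
  have hb : ∀ x ∈ ({d, d'} : Set V), ∀ v, G.Adj v x → v = b := by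
    rintro x (rfl | rfl) v hv
    · exact hB.eq_of_adj_of_adj hmiss hL hd hv hbd
    · exact hB.eq_of_adj_of_adj hmiss hL hd' hv hbd'
  refine hP.not_isModule (X := {d, d'}) (v := b) (.inl rfl) (.inr rfl) hdd'
    (by rintro (rfl | rfl); exacts [G.irrefl hbd, G.irrefl hbd']) ?_
  rintro x hx y (rfl | rfl) v - hvx
  · exact hb x hx v hvx ▸ hbd
  · exact hb x hx v hvx ▸ hbd'

theorem IsSplitBy.exists_isThinCandling [Nonempty V] (hP : IsPrime G)
    (hL : ∀ v, TwoCliques G v) (hnbr : ∀ v, ∃ x, G.Adj v x) (hconbr : ∀ v, ∃ x, Gᶜ.Adj v x) :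
    Nontrivial ↥Bᶜ ∧ ∃ z : ↥Bᶜ → V, IsThinCandling G Subtype.val z := by
  choose z hz using fun d : ↥Bᶜ => hnbr d
  have hzB : ∀ d, z d ∈ B := fun d => hB.mem_of_adj d.2 (hz d).symm
  have hz_eq : ∀ (d : ↥Bᶜ) v, G.Adj d v → v = z d := fun d v h =>
    hB.eq_of_adj_of_adj hmiss hL d.2 h.symm (hz d).symm
  have hz_inj : ∀ d d', z d = z d' → d = d' := fun d d' h =>
    Subtype.ext (hB.eq_of_adj hmiss hP hL d.2 d'.2 (h ▸ (hz d).symm) (hz d').symm)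
  refine ⟨?_, z, ?_, ?_, ?_, ?_, ?_⟩
  · obtain ⟨v⟩ := ‹Nonempty V›
    obtain ⟨x, hvx⟩ := hconbr v
    obtain ⟨d⟩ : Nonempty ↥Bᶜ := by
      by_contra! hempty
      have hmem : ∀ u, u ∈ B := fun u => by_contra fun hu => hempty.false ⟨u, hu⟩
      exact hvx.2 (hB.1 (hmem v) (hmem x) hvx.1)
    obtain ⟨u, hzu⟩ := hconbr (z d)
    have hu : u ∉ B := fun hu => hzu.2 (hB.1 (hzB d) hu hzu.1)
    refine ⟨d, ⟨u, hu⟩, ?_⟩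
    rintro rfl
    exact hzu.2 (hz _).symm
  · exact fun d d' h => hB.2 d.2 d'.2 h.ne h
  · exact fun d d' h => hB.1 (hzB d) (hzB d') (mt (hz_inj d d') h)
  · exact fun d d' => ⟨fun h => (hz_inj _ _ (hz_eq d _ h)).symm, fun h => h ▸ hz d⟩
  · rintro d v hv
    simp only [Set.mem_union, Subtype.range_coe, not_or, Set.mem_compl_iff, not_not] at hv
    exact hB.1 (hzB d) hv.1 fun h => hv.2 ⟨d, h⟩
  · exact fun d v hv h => hv (.inr ⟨d, (hz_eq d v h).symm⟩)

end Split

theorem IsInducedP4.compl {a b c d : V} (h : IsInducedP4 G a b c d) :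
    IsInducedP4 Gᶜ b d a c := by
  grind [IsInducedP4, SimpleGraph.compl_adj, G.adj_comm, G.ne_of_adj]

namespace IsThinCandling

variable {ι κ : Type*} {y z : ι → V}

theorem comp_equiv (h : IsThinCandling G y z) (e : κ ≃ ι) : IsThinCandling G (y ∘ e) (z ∘ e) where
  not_adj i j := h.not_adj _ _
  adj i j hij := h.adj _ _ (e.injective.ne hij)
  adj_iff i j := (h.adj_iff _ _).trans e.injective.eq_iff
  adj_rest i v hv := h.adj_rest _ v (by simpa only [EquivLike.range_comp] using hv)
  not_adj_rest i v hv := h.not_adj_rest _ v (by simpa only [EquivLike.range_comp] using hv)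

theorem injective_left (h : IsThinCandling G y z) : Function.Injective y := fun i j hij =>
  (h.adj_iff i j).1 (hij ▸ (h.adj_iff j j).2 rfl)

theorem injective_right (h : IsThinCandling G y z) : Function.Injective z := fun i j hij =>
  (h.adj_iff i j).1 (hij ▸ (h.adj_iff i i).2 rfl)

theorem left_ne_right (h : IsThinCandling G y z) (i j : ι) : y i ≠ z j := fun hij =>
  h.not_adj j i (hij ▸ (h.adj_iff j j).2 rfl)

theorem isInducedP4 (h : IsThinCandling G y z) {i j : ι} (hij : i ≠ j) :
    IsInducedP4 G (y i) (z i) (z j) (y j) :=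
  ⟨(h.adj_iff i i).2 rfl, h.adj i j hij, ((h.adj_iff j j).2 rfl).symm,
    mt (h.adj_iff i j).1 hij, h.not_adj i j, fun e => hij ((h.adj_iff j i).1 e.symm).symm⟩

end IsThinCandling

section Quotient

variable {W ι : Type*} {H : SimpleGraph W} {π : V → W}

theorem IsModularQuotient.adj_of_adj (hq : IsModularQuotient G H π) {u v : V}
    (h : H.Adj (π u) (π v)) : G.Adj u v :=
  (hq.adj u v h.ne).2 h

theorem IsModularQuotient.eq_or_adj (hq : IsModularQuotient G H π) {u v : V} (h : G.Adj u v) :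
    π u = π v ∨ H.Adj (π u) (π v) :=
  or_iff_not_imp_left.2 fun huv => (hq.adj u v huv).1 h

theorem FibreHasEdge.not_isInducedP4 (hq : IsModularQuotient G H π) (hG : ForkKiteFree G)
    {a b c d : W} (hb : FibreHasEdge G π b) : ¬IsInducedP4 H a b c d := by
  rintro ⟨hab, hbc, hcd, hac, had, hbd⟩
  obtain ⟨u, v, hu, hv, huv⟩ := hb
  obtain ⟨x, hx⟩ := hq.surj a
  obtain ⟨s, hs⟩ := hq.surj c
  obtain ⟨t, ht⟩ := hq.surj d
  have hadj {p q} (h : H.Adj (π p) (π q)) : G.Adj p q := hq.adj_of_adj h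
  have hnadj {p q} (hne : π p ≠ π q) (h : ¬H.Adj (π p) (π q)) : ¬G.Adj p q :=
    mt (hq.adj p q hne).1 h
  grind [H.adj_comm, G.adj_comm, hG.kite u v x s t]

theorem FibreHasEdge.isSimplicial (hP : IsPrime H) (hq : IsModularQuotient G H π)
    (hG : ForkKiteFree G) {v : W} (hv : FibreHasEdge G π v) : IsSimplicial H v := by
  intro x hx y hy hxy
  by_contra hnxy
  set C := component Hᶜ (H.neighborSet v) x
  have hsub : C ⊆ H.neighborSet v := component_subset hx
  have hyC : y ∈ C := mem_component_of_adj (mem_component_self _ x) ⟨hxy, hnxy⟩ hy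
  refine hP.not_isModule (mem_component_self _ x) hyC hxy (fun h => H.irrefl (hsub h)) ?_
  intro s hs t ht u hu hus
  by_contra hut
  obtain ⟨q, hqC, r, hr, hqr, huq, hur⟩ := component_exists_edge (P := (H.Adj u ·)) hs ht hus hut
  have hru : Hᶜ.Adj r u := ⟨fun h => hu (h ▸ hr), mt H.adj_symm hur⟩
  have hvu : ¬H.Adj v u := fun h => hu (mem_component_of_adj hr hru h)
  exact hv.not_isInducedP4 hq hG
    ⟨(hsub hr).symm, hsub hqC, huq.symm, fun h => hqr.2 h.symm, hru.2, hvu⟩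

theorem adj_of_not_fibreHasEdge_compl {w : W} (hw : ¬FibreHasEdge Gᶜ π w) {u v : V}
    (hu : π u = w) (hv : π v = w) (huv : u ≠ v) : G.Adj u v :=
  by_contra fun h => hw ⟨u, v, hu, hv, huv, h⟩

theorem IsModularQuotient.isSimplicial (hq : IsModularQuotient G H π) {x : V}
    (hx : IsSimplicial H (π x))
    (hclique : ∀ w ∈ insert (π x) (H.neighborSet (π x)), ¬FibreHasEdge Gᶜ π w) :
    IsSimplicial G x := by
  have hmem : ∀ y, G.Adj x y → π y ∈ insert (π x) (H.neighborSet (π x)) := fun y h =>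
    (hq.eq_or_adj h).imp_left Eq.symm
  have hcl : H.IsClique (insert (π x) (H.neighborSet (π x))) :=
    SimpleGraph.IsClique.insert hx fun y hy _ => hy
  intro y hy z hz hyz
  by_cases hπ : π y = π z
  · exact adj_of_not_fibreHasEdge_compl (hclique _ (hmem z hz)) hπ rfl hyz
  · exact hq.adj_of_adj (hcl (hmem y hy) (hmem z hz) hπ)

theorem FibreHasEdge.hasAdjacentSimplicialTwins (hq : IsModularQuotient G H π) {v : W}
    (hv : FibreHasEdge G π v) (hsimp : IsSimplicial H v)
    (hclique : ∀ w ∈ insert v (H.neighborSet v), ¬FibreHasEdge Gᶜ π w) :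
    HasAdjacentSimplicialTwins G := by
  obtain ⟨a, b, rfl, hb, hab⟩ := hv
  refine ⟨a, b, hab, ⟨hab.ne, fun w hwa hwb => ?_⟩, hq.isSimplicial hsimp hclique,
    hq.isSimplicial (hb ▸ hsimp) (hb ▸ hclique)⟩
  by_cases hw : π a = π w
  · have hfibre := hclique _ (Set.mem_insert _ _)
    exact iff_of_true (adj_of_not_fibreHasEdge_compl hfibre rfl hw.symm hwa.symm)
      (adj_of_not_fibreHasEdge_compl hfibre hb hw.symm hwb.symm)
  · rw [hq.adj a w hw, hq.adj b w (hb ▸ hw), hb]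

theorem IsThinCandling.not_fibreHasEdge [Nontrivial ι] {y z : ι → W} (h : IsThinCandling H y z)
    (hq : IsModularQuotient G H π) (hG : ForkKiteFree G) (i : ι) : ¬FibreHasEdge G π (z i) := by
  obtain ⟨j, hj⟩ := exists_ne i
  exact fun hi => hi.not_isInducedP4 hq hG (h.isInducedP4 hj.symm)

theorem IsThinCandling.not_fibreHasEdge_compl [Nontrivial ι] {y z : ι → W}
    (h : IsThinCandling H y z) (hq : IsModularQuotient G H π) (hG : ForkKiteFree G) (i : ι) :
    ¬FibreHasEdge Gᶜ π (y i) := by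
  obtain ⟨j, hj⟩ := exists_ne i
  exact fun hi => hi.not_isInducedP4 hq.compl hG.compl (h.isInducedP4 hj).compl

theorem IsThinCandling.isCandled [Finite ι] [Nontrivial ι] {y z : ι → W}
    (h : IsThinCandling H y z) (hq : IsModularQuotient G H π) (hG : ForkKiteFree G) :
    IsCandled G := by
  obtain ⟨k, ⟨e⟩⟩ := Finite.exists_equiv_fin ι
  replace h := h.comp_equiv e.symm
  have : Nontrivial (Fin k) := e.symm.nontrivial
  generalize y ∘ e.symm = y at h
  generalize z ∘ e.symm = z at h
  have hadj {u v a b} (hu : π u = a) (hv : π v = b) (hab : H.Adj a b) : G.Adj u v :=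
    hq.adj_of_adj (by rwa [hu, hv])
  have hnadj {u v a b} (hu : π u = a) (hv : π v = b) (hne : a ≠ b) (hab : ¬H.Adj a b) :
      ¬G.Adj u v :=
    mt (hq.adj u v (by rwa [hu, hv])).1 (by rwa [hu, hv])
  have hdisj {a b} (hab : a ≠ b) : Disjoint {v | π v = a} {v | π v = b} :=
    Set.disjoint_left.2 fun v hva hvb => hab (hva.symm.trans hvb)
  let S : Set V := π ⁻¹' (Set.range y ∪ Set.range z)
  have hmem_S {w} (hw : w ∈ Set.range y ∪ Set.range z) : ∃ v : S, π v = w := by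
    obtain ⟨v, rfl⟩ := hq.surj w
    exact ⟨⟨v, hw⟩, rfl⟩
  refine ⟨S, ⋃ i, {v | π v = z i}, ⟨k, fun i => {v | π v = y i}, fun i => {v | π v = z i},
    ?_, fun i => hmem_S (.inl ⟨i, rfl⟩), fun i => hmem_S (.inr ⟨i, rfl⟩),
    fun i j hij => (hdisj (h.injective_left.ne hij)).preimage _,
    fun i j hij => (hdisj (h.injective_right.ne hij)).preimage _,
    fun i j => (hdisj (h.left_ne_right i j)).preimage _, ?_, ?_, ?_,
    fun i j hij u hu v hv => hnadj hu hv (h.injective_left.ne hij) (h.not_adj i j),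
    fun i j hij u hu v hv => hadj hu hv (h.adj i j hij),
    fun i u hu v hv => hadj hu hv ((h.adj_iff i i).2 rfl),
    fun i j hij u hu v hv => hnadj hu hv (h.left_ne_right i j) (mt (h.adj_iff i j).1 hij), rfl⟩,
    ?_, ?_⟩
  · exact Fin.pos (Classical.arbitrary _)
  · refine Set.eq_univ_of_forall ?_
    rintro ⟨v, ⟨i, hi⟩ | ⟨i, hi⟩⟩
    exacts [.inl (Set.mem_iUnion.2 ⟨i, hi.symm⟩), .inr (Set.mem_iUnion.2 ⟨i, hi.symm⟩)]
  · exact fun i u hu v hv huv => adj_of_not_fibreHasEdge_compl (h.not_fibreHasEdge_compl hq hG i)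
      hu hv (Subtype.coe_injective.ne huv)
  · exact fun i u hu v hv _ huv => h.not_fibreHasEdge hq hG i ⟨u, v, hu, hv, huv⟩
  · rintro _ ⟨u, hu, rfl⟩ v hv
    obtain ⟨i, hi⟩ := Set.mem_iUnion.1 hu
    exact hadj hi rfl (h.adj_rest i _ hv)
  · rintro _ ⟨⟨u, ⟨i, hi⟩ | ⟨i, hi⟩⟩, hu, rfl⟩ v hv
    · exact hnadj hi.symm rfl (fun e => hv (.inl ⟨i, e⟩)) (h.not_adj_rest i _ hv)
    · exact absurd (Set.mem_iUnion.2 ⟨i, hi.symm⟩) hu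

theorem IsModularQuotient.isCandled_of_isSplitBy [Finite W] [Nontrivial W]
    (hq : IsModularQuotient G H π) (hG : ForkKiteFree G) (hP : IsPrime H)
    (hL : ∀ v, TwoCliques H v) (h₁ : ¬IsDisconnected G) (h₂ : ¬IsDisconnected Gᶜ) {B : Set W}
    (hB : IsSplitBy H B) : IsCandled G := by
  have hnbr : ∀ w, ∃ x, H.Adj w x := fun w => by
    by_contra! h
    exact h₁ (hq.isDisconnected_of_isolated h)
  have hconbr : ∀ w, ∃ x, Hᶜ.Adj w x := fun w => by
    by_contra! h
    exact h₂ (hq.compl.isDisconnected_of_isolated h)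
  obtain ⟨B, hB, hmiss⟩ := hB.exists_forall_exists_not_adj
  obtain ⟨_, z, hz⟩ := hB.exists_isThinCandling hmiss hP hL hnbr hconbr
  exact hz.isCandled hq hG

theorem IsModularQuotient.twoCliques (hq : IsModularQuotient G H π) (hπ : Function.Injective π)
    {v : V} (h : TwoCliques H (π v)) : TwoCliques G v := by
  obtain ⟨S, hS⟩ := h
  refine ⟨π ⁻¹' S, fun x y hx hy hxy => ?_⟩
  have hadj {u w} (huw : u ≠ w) : G.Adj u w ↔ H.Adj (π u) (π w) := hq.adj u w (hπ.ne huw)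
  rw [hadj hxy]
  exact hS _ _ ((hadj hx.ne).1 hx) ((hadj hy.ne).1 hy) (hπ.ne hxy)

theorem IsModularQuotient.twins_or_isCandled_or_isLineGraph [Finite V] [Finite W] [Nontrivial W]
    (hq : IsModularQuotient G H π) (hG : ForkKiteFree G) (hP : IsPrime H)
    (hL : ∀ v, TwoCliques H v) (h₁ : ¬IsDisconnected G) (h₂ : ¬IsDisconnected Gᶜ) :
    (HasAdjacentSimplicialTwins G ∨ HasAdjacentSimplicialTwins Gᶜ) ∨ IsCandled G ∨
      IsLineGraphOfTriangleFree G := by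
  by_contra! ⟨⟨htwins, htwins'⟩, hcandled, hline⟩
  have hsplit : ∀ B, ¬IsSplitBy H B := fun B hB =>
    hcandled (hq.isCandled_of_isSplitBy hG hP hL h₁ h₂ hB)
  have hsimp : ∀ {v}, FibreHasEdge G π v → IsSimplicial H v := fun h => h.isSimplicial hP hq hG
  have hsimp' : ∀ {v}, FibreHasEdge Gᶜ π v → IsSimplicial Hᶜ v := fun h =>
    h.isSimplicial hP.compl hq.compl hG.compl
  have hpure : ∀ v, FibreHasEdge G π v → ¬FibreHasEdge Gᶜ π v := fun v h h' =>
    hsplit _ (isSplitBy_of_isSimplicial (hsimp h) (hsimp' h'))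
  have hstep : ∀ v, FibreHasEdge G π v → ∃ z, H.Adj v z ∧ FibreHasEdge Gᶜ π z := by
    intro v hv
    by_contra! h
    refine htwins (hv.hasAdjacentSimplicialTwins hq (hsimp hv) ?_)
    rintro w (rfl | hw)
    exacts [hpure w hv, h w hw]
  have hstep' : ∀ z, FibreHasEdge Gᶜ π z → ∃ v, Hᶜ.Adj z v ∧ FibreHasEdge G π v := by
    intro z hz
    by_contra! h
    refine htwins' (hz.hasAdjacentSimplicialTwins hq.compl (hsimp' hz) ?_)
    rw [compl_compl]
    rintro w (rfl | hw)
    exacts [fun h => hpure w h hz, h w hw]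
  have hstable : ∀ z, ¬FibreHasEdge Gᶜ π z := by
    intro z hz
    obtain ⟨v, hzv, hv⟩ := hstep' z hz
    obtain ⟨z', hvz', hz'⟩ := hstep v hv
    exact hsplit _ ((hL z').isSplitBy (hsimp hv) (hsimp' hz) (hsimp' hz') hzv hvz')
  have hinj : Function.Injective π := by
    intro u v huv
    by_contra hne
    have hadj : G.Adj u v := adj_of_not_fibreHasEdge_compl (hstable (π v)) huv rfl hne
    obtain ⟨z, -, hz⟩ := hstep (π v) ⟨u, v, huv, rfl, hadj⟩
    exact hstable z hz
  exact hline (isLineGraphOfTriangleFree fun v => hq.twoCliques hinj (hL (π v)))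

end Quotient

end Uncluttered

theorem theorem2p1 {V : Type*} [Finite V] (G : SimpleGraph V)
    (hG : Uncluttered.IsUncluttered G) :
    (Uncluttered.IsDisconnected G ∨ Uncluttered.IsDisconnected Gᶜ) ∨
    (Uncluttered.HasAdjacentSimplicialTwins G ∨ Uncluttered.HasAdjacentSimplicialTwins Gᶜ) ∨
    (Uncluttered.IsCandled G ∨ Uncluttered.IsCandled Gᶜ) ∨
    (Uncluttered.IsLineGraphOfTriangleFree G ∨ Uncluttered.IsLineGraphOfTriangleFree Gᶜ) := by
  rcases subsingleton_or_nontrivial V with hV | hV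
  · exact .inr (.inr (.inr (.inl (Uncluttered.isLineGraphOfTriangleFree fun v =>
      ⟨∅, fun x _ hx => absurd (Subsingleton.elim v x) hx.ne⟩))))
  by_cases h₁ : Uncluttered.IsDisconnected G
  · exact .inl (.inl h₁)
  by_cases h₂ : Uncluttered.IsDisconnected Gᶜ
  · exact .inl (.inr h₂)
  have hfree := hG.forkKiteFree
  obtain ⟨W, _, _, H, π, hq, hP⟩ := Uncluttered.exists_isModularQuotient h₁ h₂
  rcases hP.twoCliques_or_compl (hq.forkKiteFree hfree) with hL | hL
  · have := hq.twins_or_isCandled_or_isLineGraph hfree hP hL h₁ h₂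
    tauto
  · have := hq.compl.twins_or_isCandled_or_isLineGraph hfree.compl hP.compl hL h₂
      (by rwa [compl_compl])
    rw [compl_compl] at this
    tauto
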